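/- Let $\mathbb D$ be the open unit disk, $dA$ the normalized area measure on $\mathbb D$, and let $\nu:\mathbb D\to(0,\infty)$ be continuous and radial, i.e. $\nu(z)=\nu(|z|)$. For $1<p<\infty$ let $B^p$ be the space of analytic functions $f$ on $\mathbb D$ with $\int_{\mathbb D}|f'(z)|^p(1-|z|^2)^{p-2}\,dA(z)<\infty$, with norm $$\|f\|_p=|f(0)|+\Big[\int_{\mathbb D}|f'(z)|^p(1-|z|^2)^{p-2}\,dA(z)\Big]^{1/p}.$$ Let $B^1$ be the space of analytic $f$ on $\mathbb D$ with $\int_{\mathbb D}|f''|\,dA<\infty$, with norm $\|f\|_1=\inf\sum_{j\ge 0}|c_j|$, the infimum being over all representations $f=c_0+\sum_{j\ge1}c_j\alpha_{w_j}$ on $\mathbb D$ with $(c_j)\in\ell^1$ and $w_j\in\mathbb D$, where $\alpha_w(z)=(w-z)/(1-\overline w z)$. Let $\mathcal B_{\nu,0}$ be the space of analytic $f$ on $\mathbb D$ with $\sup_{z\in\mathbb D}\nu(z)|f'(z)|<\infty$ and $\nu(z)|f'(z)|\to0$ as $|z|\to1^-$, with norm $|f(0)|+\sup_{z\in\mathbb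 D}\nu(z)|f'(z)|$. Write $\rho(z,w)=\left|\frac{z-w}{1-\overline z w}\right|$ for the pseudo-hyperbolic distance. **Theorem.** Let $1\le p<\infty$ and let $\varphi,\psi:\mathbb D\to\mathbb D$ be analytic. Then $C_\varphi-C_\psi: f\mapsto f\circ\varphi-f\circ\psi$ is a compact linear operator from $B^p$ into $\mathcal B_{\nu,0}$ (in particular it maps $B^p$ into $\mathcal B_{\nu,0}$) if and only if the following two conditions hold: (a) $\displaystyle\lim_{|z|\to1^-}\max\left\{\frac{|\varphi'(z)|}{1-|\varphi(z)|^2},\frac{|\psi'(z)|}{1-|\psi(z)|^2}\right\}\nu(z)\,\rho(\varphi(z),\psi(z))=0$; (b) $\displaystyle\lim_{|z|\to1^-}\left|\frac{\nu(z)\varphi'(z)}{1-|\varphi(z)|^2}-\frac{\nu(z)\psi'(z)}{1-|\psi(z)|^2}\right|=0$. -/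

import Mathlib

open Set Filter Topology MeasureTheory
open scoped ENNReal

noncomputable section

namespace DiffComp

/-- The open unit disk. -/
def disk : Set ℂ := Metric.ball (0 : ℂ) 1

/-- The normalized area measure on the disk. -/
def diskArea : Measure ℂ := (ENNReal.ofReal Real.pi)⁻¹ • volume.restrict disk

/-- The filter `|z| → 1⁻`. -/
def toCircle : Filter ℂ := comap (fun z : ℂ => ‖z‖) (𝓝[<] (1 : ℝ))

/-- The automorphism `z ↦ (w - z) / (1 - conj w * z)` of the disk, for `w` in the disk. -/
def mobius (w z : ℂ) : ℂ := (w - z) / (1 - (starRingEnd ℂ) w * z)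

/-- The pseudo-hyperbolic distance on the disk. -/
def pseudoHyp (z w : ℂ) : ℝ := ‖mobius w z‖

/-- Analytic functions on the disk. Such a function is represented by its extension by zero to `ℂ`,
so that two elements are equal exactly when they agree on the disk. -/
def holoDisk : Submodule ℂ (ℂ → ℂ) where
  carrier := {f | DifferentiableOn ℂ f disk ∧ ∀ z ∉ disk, f z = 0}
  zero_mem' := ⟨differentiableOn_const 0, fun _ _ => rfl⟩
  add_mem' := fun hf hg => ⟨hf.1.add hg.1, fun z hz => by simp [hf.2 z hz, hg.2 z hz]⟩
  smul_mem' := fun c f hf => ⟨hf.1.const_smul c, fun z hz => by simp [hf.2 z hz]⟩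

theorem isOpen_disk : IsOpen disk := Metric.isOpen_ball

theorem deriv_add_disk {f g : ℂ → ℂ} (hf : DifferentiableOn ℂ f disk)
    (hg : DifferentiableOn ℂ g disk) {z : ℂ} (hz : z ∈ disk) :
    deriv (f + g) z = deriv f z + deriv g z :=
  deriv_add (hf.differentiableAt (isOpen_disk.mem_nhds hz))
    (hg.differentiableAt (isOpen_disk.mem_nhds hz))

theorem deriv_smul_disk (c : ℂ) (f : ℂ → ℂ) (z : ℂ) : deriv (c • f) z = c * deriv f z := by
  have h : c • f = fun y => c * f y := rfl
  rw [h, deriv_const_mul_field]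

theorem deriv2_add_disk {f g : ℂ → ℂ} (hf : DifferentiableOn ℂ f disk)
    (hg : DifferentiableOn ℂ g disk) {z : ℂ} (hz : z ∈ disk) :
    deriv (deriv (f + g)) z = deriv (deriv f) z + deriv (deriv g) z := by
  have h : deriv (f + g) =ᶠ[𝓝 z] deriv f + deriv g := by
    filter_upwards [isOpen_disk.mem_nhds hz] with y hy
    exact deriv_add_disk hf hg hy
  rw [h.deriv_eq]
  exact deriv_add_disk (hf.deriv isOpen_disk) (hg.deriv isOpen_disk) hz

theorem deriv2_smul_disk (c : ℂ) (f : ℂ → ℂ) (z : ℂ) :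
    deriv (deriv (c • f)) z = c * deriv (deriv f) z := by
  have h : deriv (c • f) = c • deriv f := funext fun y => by
    rw [deriv_smul_disk, Pi.smul_apply, smul_eq_mul]
  rw [h, deriv_smul_disk]

theorem ae_disk : ∀ᵐ z ∂diskArea, z ∈ disk :=
  Measure.ae_smul_measure (ae_restrict_mem isOpen_disk.measurableSet) _

/-! ### Analytic Besov spaces -/

/-- `∫ |f'|^p (1 - |z|²)^(p-2) dA`. -/
def besovIntegral (p : ℝ) (f : ℂ → ℂ) : ℝ≥0∞ :=
  ∫⁻ z, ‖deriv f z‖ₑ ^ p * ENNReal.ofReal ((1 - ‖z‖ ^ 2) ^ (p - 2)) ∂diskArea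

/-- `∫ |f''| dA`. -/
def secondIntegral (f : ℂ → ℂ) : ℝ≥0∞ := ∫⁻ z, ‖deriv (deriv f) z‖ₑ ∂diskArea

/-- `f = c₀ + ∑_{j ≥ 1} c_j α_{w_j}` on the disk, with `c ∈ ℓ¹` and all `w_j` in the disk. The
points are stored with the index shifted by one. -/
structure IsAtomicDecomp (f : ℂ → ℂ) (c w : ℕ → ℂ) : Prop where
  summable : Summable fun j => ‖c j‖
  mem : ∀ j, w j ∈ disk
  hasSum : ∀ z ∈ disk, HasSum (fun j => c (j + 1) * mobius (w j) z) (f z - c 0)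

/-- The infimum of `∑ |c_j|` over all atomic decompositions (`∞` if there is none). -/
def atomicNorm (f : ℂ → ℂ) : ℝ≥0∞ :=
  ⨅ (c : ℕ → ℂ) (w : ℕ → ℂ) (_ : IsAtomicDecomp f c w), ∑' j, ‖c j‖ₑ

/-- The norm of the analytic Besov space `B^p`, `1 ≤ p < ∞`. -/
def besovNorm (p : ℝ) (f : ℂ → ℂ) : ℝ≥0∞ :=
  if p = 1 then atomicNorm f else ‖f 0‖ₑ + besovIntegral p f ^ (1 / p)

theorem minkowski (p : ℝ) (hp : 1 ≤ p) {f g : ℂ → ℂ} (hf : DifferentiableOn ℂ f disk)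
    (hg : DifferentiableOn ℂ g disk) :
    besovIntegral p (f + g) ^ (1 / p)
      ≤ besovIntegral p f ^ (1 / p) + besovIntegral p g ^ (1 / p) := by
  have hw : Measurable fun z : ℂ => ENNReal.ofReal ((1 - ‖z‖ ^ 2) ^ (p - 2)) := by fun_prop
  have key : ∀ F : ℂ → ℝ≥0∞, Measurable F →
      ∫⁻ z, F z ^ p * ENNReal.ofReal ((1 - ‖z‖ ^ 2) ^ (p - 2)) ∂diskArea
        = ∫⁻ z, F z ^ p ∂(diskArea.withDensity
            fun z : ℂ => ENNReal.ofReal ((1 - ‖z‖ ^ 2) ^ (p - 2))) := by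
    intro F hF
    rw [lintegral_withDensity_eq_lintegral_mul _ hw (hF.pow_const p)]
    exact lintegral_congr fun z => mul_comm _ _
  have mf : Measurable fun z => ‖deriv f z‖ₑ := (measurable_deriv f).enorm
  have mg : Measurable fun z => ‖deriv g z‖ₑ := (measurable_deriv g).enorm
  have h1 : besovIntegral p (f + g)
      ≤ ∫⁻ z, ((fun z => ‖deriv f z‖ₑ) + fun z => ‖deriv g z‖ₑ) z ^ p
          * ENNReal.ofReal ((1 - ‖z‖ ^ 2) ^ (p - 2)) ∂diskArea := by
    refine lintegral_mono_ae ?_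
    filter_upwards [ae_disk] with z hz
    rw [deriv_add_disk hf hg hz]
    gcongr
    exact enorm_add_le _ _
  refine (ENNReal.rpow_le_rpow h1 (by positivity)).trans ?_
  rw [key _ (mf.add mg), besovIntegral, besovIntegral, key _ mf, key _ mg]
  exact ENNReal.lintegral_Lp_add_le mf.aemeasurable mg.aemeasurable hp

theorem besovIntegral_smul (p : ℝ) (hp : 1 ≤ p) (c : ℂ) (f : ℂ → ℂ) :
    besovIntegral p (c • f) = ‖c‖ₑ ^ p * besovIntegral p f := by
  have hw : Measurable fun z : ℂ => ENNReal.ofReal ((1 - ‖z‖ ^ 2) ^ (p - 2)) := by fun_prop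
  have mf : Measurable fun z => ‖deriv f z‖ₑ := (measurable_deriv f).enorm
  have mF : Measurable fun z : ℂ =>
      ‖deriv f z‖ₑ ^ p * ENNReal.ofReal ((1 - ‖z‖ ^ 2) ^ (p - 2)) := (mf.pow_const p).mul hw
  rw [besovIntegral, besovIntegral, ← lintegral_const_mul _ mF]
  refine lintegral_congr fun z => ?_
  rw [deriv_smul_disk, enorm_mul, ENNReal.mul_rpow_of_nonneg _ _ (by linarith), mul_assoc]

theorem secondIntegral_add_le {f g : ℂ → ℂ} (hf : DifferentiableOn ℂ f disk)
    (hg : DifferentiableOn ℂ g disk) :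
    secondIntegral (f + g) ≤ secondIntegral f + secondIntegral g := by
  have mf : Measurable fun z => ‖deriv (deriv f) z‖ₑ := (measurable_deriv _).enorm
  rw [secondIntegral, secondIntegral, secondIntegral, ← lintegral_add_left mf]
  refine lintegral_mono_ae ?_
  filter_upwards [ae_disk] with z hz
  rw [deriv2_add_disk hf hg hz]
  exact enorm_add_le _ _

theorem secondIntegral_smul (c : ℂ) (f : ℂ → ℂ) :
    secondIntegral (c • f) = ‖c‖ₑ * secondIntegral f := by
  have mf : Measurable fun z => ‖deriv (deriv f) z‖ₑ := (measurable_deriv _).enorm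
  rw [secondIntegral, secondIntegral, ← lintegral_const_mul _ mf]
  exact lintegral_congr fun z => by rw [deriv2_smul_disk, enorm_mul]

theorem atomicNorm_zero : atomicNorm 0 = 0 := by
  refine le_antisymm ?_ bot_le
  refine iInf_le_of_le 0 (iInf_le_of_le 0 (iInf_le_of_le ⟨?_, ?_, ?_⟩ ?_))
  · simp [summable_zero]
  · intro j
    simp [disk]
  · intro z _
    simp [hasSum_zero]
  · simp

theorem atomicNorm_neg_le (f : ℂ → ℂ) : atomicNorm (-f) ≤ atomicNorm f := by
  refine le_iInf fun c => le_iInf fun w => le_iInf fun h => ?_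
  refine iInf_le_of_le (-c) (iInf_le_of_le w (iInf_le_of_le ⟨?_, h.mem, ?_⟩ ?_))
  · simpa using h.summable
  · intro z hz
    have h1 := (h.hasSum z hz).neg
    have h2 : -(f z - c 0) = (-f) z - (-c) 0 := by
      simp only [Pi.neg_apply]
      ring
    have h3 : (fun j => -(c (j + 1) * mobius (w j) z))
        = fun j => (-c) (j + 1) * mobius (w j) z := funext fun j => by
      simp only [Pi.neg_apply]
      ring
    rwa [h2, h3] at h1
  · simp

theorem atomicNorm_add_le (f g : ℂ → ℂ) : atomicNorm (f + g) ≤ atomicNorm f + atomicNorm g := by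
  have key : ∀ c w, IsAtomicDecomp f c w → ∀ d v, IsAtomicDecomp g d v →
      atomicNorm (f + g) ≤ (∑' j, ‖c j‖ₑ) + ∑' j, ‖d j‖ₑ := by
    intro c w hc d v hd
    let e : ℕ → ℂ := fun n => if n % 2 = 0 then c (n / 2 + 1) else d (n / 2 + 1)
    let u : ℕ → ℂ := fun n => if n % 2 = 0 then w (n / 2) else v (n / 2)
    let b : ℕ → ℂ := fun n => if n = 0 then c 0 + d 0 else e (n - 1)
    have e0 : ∀ k, e (2 * k) = c (k + 1) := fun k => by simp [e]
    have e1 : ∀ k, e (2 * k + 1) = d (k + 1) := fun k => by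
      have : (2 * k + 1) / 2 = k := by omega
      simp [e, this]
    have u0 : ∀ k, u (2 * k) = w k := fun k => by simp [u]
    have u1 : ∀ k, u (2 * k + 1) = v k := fun k => by
      have : (2 * k + 1) / 2 = k := by omega
      simp [u, this]
    have b0 : b 0 = c 0 + d 0 := by simp [b]
    have b1 : ∀ n, b (n + 1) = e n := fun n => by simp [b]
    have hdec : IsAtomicDecomp (f + g) b u := by
      refine ⟨?_, ?_, ?_⟩
      · rw [← summable_nat_add_iff 1]
        simp only [b1]
        have hc1 := (summable_nat_add_iff 1).2 hc.summable
        have hd1 := (summable_nat_add_iff 1).2 hd.summable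
        refine (HasSum.even_add_odd (f := fun n => ‖e n‖) (m := ∑' j, ‖c (j + 1)‖)
          (m' := ∑' j, ‖d (j + 1)‖) ?_ ?_).summable
        · simpa only [e0] using hc1.hasSum
        · simpa only [e1] using hd1.hasSum
      · intro j
        simp only [u]
        split_ifs
        · exact hc.mem _
        · exact hd.mem _
      · intro z hz
        have h := HasSum.even_add_odd (f := fun n => e n * mobius (u n) z)
          (m := f z - c 0) (m' := g z - d 0)
          (by simpa only [e0, u0] using hc.hasSum z hz)
          (by simpa only [e1, u1] using hd.hasSum z hz)
        simp only [b1, b0, Pi.add_apply]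
        convert h using 1
        ring
    have hle : atomicNorm (f + g) ≤ ∑' j, ‖b j‖ₑ :=
      iInf_le_of_le b (iInf_le_of_le u (iInf_le_of_le hdec le_rfl))
    refine hle.trans ?_
    have hz : ∀ a : ℕ → ℝ≥0∞, ∑' j, a j = a 0 + ∑' j, a (j + 1) := fun a =>
      tsum_eq_zero_add' ENNReal.summable
    have he : ∑' j, ‖e j‖ₑ = ∑' k, ‖c (k + 1)‖ₑ + ∑' k, ‖d (k + 1)‖ₑ := by
      have h := tsum_even_add_odd (f := fun n => ‖e n‖ₑ) ENNReal.summable ENNReal.summable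
      simpa only [e0, e1] using h.symm
    have hb : ∑' j, ‖b j‖ₑ = ‖c 0 + d 0‖ₑ + ∑' j, ‖e j‖ₑ := by
      rw [hz fun j => ‖b j‖ₑ]
      simp only [b0, b1]
    rw [hb, he, hz fun j => ‖c j‖ₑ, hz fun j => ‖d j‖ₑ]
    refine (add_le_add_left (enorm_add_le (c 0) (d 0)) _).trans (le_of_eq ?_)
    exact add_add_add_comm _ _ _ _
  conv_rhs => simp only [atomicNorm, ENNReal.iInf_add, ENNReal.add_iInf]
  exact le_iInf fun d => le_iInf fun v => le_iInf fun hd =>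
    le_iInf fun c => le_iInf fun w => le_iInf fun hc => key c w hc d v hd

theorem besovNorm_zero (p : ℝ) (hp : 1 ≤ p) : besovNorm p 0 = 0 := by
  have h0 : (0 : ℂ → ℂ) = (0 : ℂ) • (0 : ℂ → ℂ) := by simp
  have h1 : besovIntegral p 0 = 0 := by
    rw [h0, besovIntegral_smul p hp]
    simp [ENNReal.zero_rpow_of_pos (show (0 : ℝ) < p by linarith)]
  have h2 : (0 : ℝ) < 1 / p := by positivity
  unfold besovNorm
  split_ifs
  · exact atomicNorm_zero
  · rw [h1, ENNReal.zero_rpow_of_pos h2]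
    simp

theorem besovNorm_neg_le (p : ℝ) (hp : 1 ≤ p) (f : ℂ → ℂ) :
    besovNorm p (-f) ≤ besovNorm p f := by
  have h1 : besovIntegral p (-f) = besovIntegral p f := by
    rw [← neg_one_smul ℂ f, besovIntegral_smul p hp]
    simp
  unfold besovNorm
  split_ifs
  · exact atomicNorm_neg_le f
  · rw [h1]
    simp

theorem besovNorm_add_le (p : ℝ) (hp : 1 ≤ p) {f g : ℂ → ℂ} (hf : DifferentiableOn ℂ f disk)
    (hg : DifferentiableOn ℂ g disk) :
    besovNorm p (f + g) ≤ besovNorm p f + besovNorm p g := by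
  unfold besovNorm
  split_ifs
  · exact atomicNorm_add_le f g
  · calc _ ≤ (‖f 0‖ₑ + ‖g 0‖ₑ) + (besovIntegral p f ^ (1 / p) + besovIntegral p g ^ (1 / p)) :=
          add_le_add (enorm_add_le _ _) (minkowski p hp hf hg)
      _ = _ := by ring

/-- The space `B^p`: for `p > 1` the analytic `f` with `∫ |f'|^p (1 - |z|²)^(p-2) dA < ∞`, for
`p = 1` the analytic `f` with `∫ |f''| dA < ∞`. -/
def besovSubmodule (p : ℝ) [hp : Fact (1 ≤ p)] : Submodule ℂ (ℂ → ℂ) where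
  carrier := {f | f ∈ holoDisk ∧ (if p = 1 then secondIntegral f else besovIntegral p f) < ∞}
  zero_mem' := by
    refine ⟨holoDisk.zero_mem, ?_⟩
    have h0 : (0 : ℂ → ℂ) = (0 : ℂ) • (0 : ℂ → ℂ) := by simp
    have h1 : (0 : ℝ) < p := by linarith [hp.out]
    split_ifs
    · rw [h0, secondIntegral_smul]
      simp
    · rw [h0, besovIntegral_smul p hp.out]
      simp [ENNReal.zero_rpow_of_pos h1]
  add_mem' := by
    rintro f g ⟨hf, hf'⟩ ⟨hg, hg'⟩
    refine ⟨holoDisk.add_mem hf hg, ?_⟩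
    have h1 : (0 : ℝ) < 1 / p := by
      have := hp.out
      positivity
    split_ifs at hf' hg' ⊢
    · exact (secondIntegral_add_le hf.1 hg.1).trans_lt (ENNReal.add_lt_top.2 ⟨hf', hg'⟩)
    · rw [← ENNReal.rpow_lt_top_iff_of_pos h1] at hf' hg' ⊢
      exact (minkowski p hp.out hf.1 hg.1).trans_lt (ENNReal.add_lt_top.2 ⟨hf', hg'⟩)
  smul_mem' := by
    rintro c f ⟨hf, hf'⟩
    refine ⟨holoDisk.smul_mem c hf, ?_⟩
    split_ifs at hf' ⊢
    · rw [secondIntegral_smul]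
      exact ENNReal.mul_lt_top enorm_lt_top hf'
    · rw [besovIntegral_smul p hp.out]
      exact ENNReal.mul_lt_top
        (ENNReal.rpow_lt_top_of_nonneg (by linarith [hp.out]) enorm_ne_top) hf'

/-- The analytic Besov space `B^p` as a type of its own; its topology is the one of the metric
`‖f - g‖_p`, not that of pointwise convergence. -/
def Besov (p : ℝ) [Fact (1 ≤ p)] : Type := ↥(besovSubmodule p)

instance (p : ℝ) [Fact (1 ≤ p)] : AddCommGroup (Besov p) :=
  inferInstanceAs (AddCommGroup ↥(besovSubmodule p))

instance (p : ℝ) [Fact (1 ≤ p)] : Module ℂ (Besov p) :=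
  inferInstanceAs (Module ℂ ↥(besovSubmodule p))

instance (p : ℝ) [Fact (1 ≤ p)] : CoeFun (Besov p) (fun _ => ℂ → ℂ) := ⟨fun f => f.1⟩

instance (p : ℝ) [hp : Fact (1 ≤ p)] : PseudoEMetricSpace (Besov p) where
  edist f g := besovNorm p (f.1 - g.1)
  edist_self f := by
    rw [sub_self, besovNorm_zero p hp.out]
  edist_comm f g := by
    refine le_antisymm ?_ ?_
    · rw [← neg_sub]
      exact besovNorm_neg_le p hp.out _
    · rw [← neg_sub]
      exact besovNorm_neg_le p hp.out _
  edist_triangle f g h := by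
    rw [← sub_add_sub_cancel f.1 g.1 h.1]
    exact besovNorm_add_le p hp.out (f.2.1.1.sub g.2.1.1) (g.2.1.1.sub h.2.1.1)

/-! ### Weighted Bloch type spaces -/

/-- `sup_{z ∈ 𝔻} ν(z) |f'(z)|`. -/
def blochSeminorm (ν : ℂ → ℝ) (f : ℂ → ℂ) : ℝ≥0∞ :=
  ⨆ z ∈ disk, ENNReal.ofReal (ν z) * ‖deriv f z‖ₑ

/-- The norm `|f(0)| + sup_{z ∈ 𝔻} ν(z) |f'(z)|`. -/
def blochNorm (ν : ℂ → ℝ) (f : ℂ → ℂ) : ℝ≥0∞ := ‖f 0‖ₑ + blochSeminorm ν f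

theorem blochSeminorm_add_le (ν : ℂ → ℝ) {f g : ℂ → ℂ} (hf : DifferentiableOn ℂ f disk)
    (hg : DifferentiableOn ℂ g disk) :
    blochSeminorm ν (f + g) ≤ blochSeminorm ν f + blochSeminorm ν g := by
  refine iSup₂_le fun z hz => ?_
  rw [deriv_add_disk hf hg hz]
  calc _ ≤ ENNReal.ofReal (ν z) * ‖deriv f z‖ₑ + ENNReal.ofReal (ν z) * ‖deriv g z‖ₑ := by
        rw [← mul_add]
        gcongr
        exact enorm_add_le _ _
    _ ≤ _ := add_le_add
        (le_iSup₂ (f := fun z (_ : z ∈ disk) => ENNReal.ofReal (ν z) * ‖deriv f z‖ₑ) z hz)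
        (le_iSup₂ (f := fun z (_ : z ∈ disk) => ENNReal.ofReal (ν z) * ‖deriv g z‖ₑ) z hz)

theorem blochSeminorm_smul (ν : ℂ → ℝ) (c : ℂ) (f : ℂ → ℂ) :
    blochSeminorm ν (c • f) = ‖c‖ₑ * blochSeminorm ν f := by
  simp only [blochSeminorm, ENNReal.mul_iSup]
  refine iSup_congr fun z => iSup_congr fun _ => ?_
  rw [deriv_smul_disk, enorm_mul]
  ring

theorem eventually_disk : ∀ᶠ z in toCircle, z ∈ disk := by
  have h : ∀ᶠ r in 𝓝[<] (1 : ℝ), r < 1 := eventually_mem_nhdsWithin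
  filter_upwards [h.comap (fun z : ℂ => ‖z‖)] with z hz
  simpa [disk] using hz

/-- The little Bloch type space: analytic `f` with `sup ν |f'| < ∞` and `ν(z) |f'(z)| → 0` as
`|z| → 1⁻`. -/
def littleBlochSubmodule (ν : ℂ → ℝ) : Submodule ℂ (ℂ → ℂ) where
  carrier := {f | f ∈ holoDisk ∧ blochSeminorm ν f < ∞ ∧
    Tendsto (fun z => ν z * ‖deriv f z‖) toCircle (𝓝 0)}
  zero_mem' := by
    have h0 : (0 : ℂ → ℂ) = (0 : ℂ) • (0 : ℂ → ℂ) := by simp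
    refine ⟨holoDisk.zero_mem, ?_, ?_⟩
    · rw [h0, blochSeminorm_smul]
      simp
    · have : ∀ z, deriv (0 : ℂ → ℂ) z = 0 := fun z => by
        rw [h0, deriv_smul_disk, zero_mul]
      simpa only [this, norm_zero, mul_zero] using tendsto_const_nhds
  add_mem' := by
    rintro f g ⟨hf, hf', hf''⟩ ⟨hg, hg', hg''⟩
    refine ⟨holoDisk.add_mem hf hg,
      (blochSeminorm_add_le ν hf.1 hg.1).trans_lt (ENNReal.add_lt_top.2 ⟨hf', hg'⟩), ?_⟩
    have h := hf''.norm.add hg''.norm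
    rw [norm_zero, add_zero] at h
    refine squeeze_zero_norm' ?_ h
    filter_upwards [eventually_disk] with z hz
    rw [deriv_add_disk hf.1 hg.1 hz, norm_mul, norm_mul, norm_mul, norm_norm, norm_norm, norm_norm,
      ← mul_add]
    gcongr
    exact norm_add_le _ _
  smul_mem' := by
    rintro c f ⟨hf, hf', hf''⟩
    refine ⟨holoDisk.smul_mem c hf, ?_, ?_⟩
    · rw [blochSeminorm_smul]
      exact ENNReal.mul_lt_top enorm_lt_top hf'
    · have h := hf''.const_mul ‖c‖
      rw [mul_zero] at h
      refine h.congr fun z => ?_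
      rw [deriv_smul_disk, norm_mul]
      ring

/-- The little Bloch type space as a type of its own, with the topology of the metric
`‖f - g‖` given by the Bloch norm. -/
def LittleBloch (ν : ℂ → ℝ) : Type := ↥(littleBlochSubmodule ν)

instance (ν : ℂ → ℝ) : AddCommGroup (LittleBloch ν) :=
  inferInstanceAs (AddCommGroup ↥(littleBlochSubmodule ν))

instance (ν : ℂ → ℝ) : Module ℂ (LittleBloch ν) :=
  inferInstanceAs (Module ℂ ↥(littleBlochSubmodule ν))

instance (ν : ℂ → ℝ) : CoeFun (LittleBloch ν) (fun _ => ℂ → ℂ) := ⟨fun f => f.1⟩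

theorem blochNorm_neg (ν : ℂ → ℝ) (f : ℂ → ℂ) : blochNorm ν (-f) = blochNorm ν f := by
  unfold blochNorm
  rw [← neg_one_smul ℂ f, blochSeminorm_smul]
  simp

instance (ν : ℂ → ℝ) : PseudoEMetricSpace (LittleBloch ν) where
  edist f g := blochNorm ν (f.1 - g.1)
  edist_self f := by
    rw [sub_self]
    have h0 : (0 : ℂ → ℂ) = (0 : ℂ) • (0 : ℂ → ℂ) := by simp
    rw [blochNorm, h0, blochSeminorm_smul]
    simp
  edist_comm f g := by
    rw [← neg_sub, blochNorm_neg]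
  edist_triangle f g h := by
    rw [← sub_add_sub_cancel f.1 g.1 h.1]
    calc _ ≤ (‖(f.1 - g.1) 0‖ₑ + ‖(g.1 - h.1) 0‖ₑ)
          + (blochSeminorm ν (f.1 - g.1) + blochSeminorm ν (g.1 - h.1)) :=
          add_le_add (enorm_add_le _ _)
            (blochSeminorm_add_le ν (f.2.1.1.sub g.2.1.1) (g.2.1.1.sub h.2.1.1))
      _ = _ := by
          unfold blochNorm
          ring

end DiffComp

end

namespace DiffComp

/-! Put A = νφ'/(1 - |φ|²) and B = νψ'/(1 - |ψ|²). The space `B^p` enters in only two ways: it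
embeds in the Bloch space, and it contains all automorphisms α_w with norms bounded uniformly in w.
The conditions on φ and ψ therefore do not depend on p.

Sufficiency. With F(u) = (1 - |u|²) f'(u), one has ν (f∘φ - f∘ψ)' = A (F(φ) - F(ψ)) + (A - B) F(ψ).
For a Bloch function, F is bounded and Lipschitz for the pseudo-hyperbolic distance
(`BlochBound.sub_le`), so the expression is at most a Bloch constant times a quantity that (a) and
(b) make vanish at the boundary (`BlochBound.mul_norm_deriv_diffComp_le`). This estimate is uniform
over Bloch-bounded families; on compact subsets of the disk, normal families take over. Together
they show that Bloch-bounded functions vanishing at 0 have a compact image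
(`isCompact_image_blochBound`).

Necessity. A compact operator sends suitably small multiples of all α_w into one compact set, on
which ν|g'| tends to 0 at the boundary uniformly. Hence A K_w(φ) - B K_w(ψ) tends to 0 uniformly in
w, where K_w is `mobiusKernel`. For fixed z, three choices of w then bound Aρ, Bρ and A - B
(`mobiusKernel_test`).

For p = 1 membership is defined by ∫|f''| and the norm by atoms. Their equivalence is never needed:
the integral yields a Bloch bound without control by the norm, enough for the operator to be
defined, and the norm yields the quantitative bound behind continuity and compactness. -/

theorem mem_disk {z : ℂ} : z ∈ disk ↔ ‖z‖ < 1 := by simp [disk]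

theorem one_sub_norm_sq_pos {z : ℂ} (hz : z ∈ disk) : 0 < 1 - ‖z‖ ^ 2 := by
  rw [mem_disk] at hz
  nlinarith [norm_nonneg z]

/-! ### Bloch functions: Cauchy estimates and the pseudo-hyperbolic Lipschitz property -/

/-- The bound `(1 - |z|²) |f'(z)| ≤ M` on the disk. -/
def BlochBound (M : ℝ) (f : ℂ → ℂ) : Prop := ∀ z ∈ disk, (1 - ‖z‖ ^ 2) * ‖deriv f z‖ ≤ M

theorem BlochBound.nonneg {M : ℝ} {f : ℂ → ℂ} (h : BlochBound M f) : 0 ≤ M := by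
  have := h 0 (by simp [mem_disk])
  have h2 := norm_nonneg (deriv f 0)
  simp at this
  linarith

theorem BlochBound.norm_deriv_le {M : ℝ} {f : ℂ → ℂ} (h : BlochBound M f) {z : ℂ} (hz : z ∈ disk) :
    ‖deriv f z‖ ≤ M / (1 - ‖z‖) := by
  have h1 := h z hz
  rw [mem_disk] at hz
  rw [le_div_iff₀ (by linarith)]
  nlinarith [mul_nonneg (mul_nonneg (norm_nonneg (deriv f z)) (norm_nonneg z)) (sub_nonneg.2 hz.le)]

theorem one_sub_norm_ge_half {z u : ℂ} (h : ‖u - z‖ ≤ (1 - ‖z‖) / 2) :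
    (1 - ‖z‖) / 2 ≤ 1 - ‖u‖ := by
  have : ‖u‖ ≤ ‖u - z‖ + ‖z‖ := by simpa using norm_add_le (u - z) z
  linarith

theorem closedBall_half_subset_disk {z : ℂ} (hz : z ∈ disk) :
    Metric.closedBall z ((1 - ‖z‖) / 2) ⊆ disk := by
  intro u hu
  rw [mem_closedBall_iff_norm] at hu
  rw [mem_disk] at hz ⊢
  linarith [one_sub_norm_ge_half hu]

/-- Cauchy's estimate for f' on the circle of radius (1 - |z|)/2 about z. On it the distance to the
boundary is at least halved at worst, so each of f' and the radius contributes a factor 2. -/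
theorem BlochBound.norm_deriv_deriv_le {M : ℝ} {f : ℂ → ℂ} (hf : DifferentiableOn ℂ f disk)
    (h : BlochBound M f) {z : ℂ} (hz : z ∈ disk) :
    ‖deriv (deriv f) z‖ ≤ 4 * M / (1 - ‖z‖) ^ 2 := by
  have hz' := mem_disk.1 hz
  have hd : 0 < (1 - ‖z‖) / 2 := by linarith
  have h1 := Complex.norm_deriv_le_of_forall_mem_sphere_norm_le (f := deriv f) hd
    (C := M / ((1 - ‖z‖) / 2))
    (((hf.deriv isOpen_disk).mono (closedBall_half_subset_disk hz)).diffContOnCl_ball subset_rfl)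
    (fun u hu => by
      have hu' := Metric.sphere_subset_closedBall hu
      refine (h.norm_deriv_le (closedBall_half_subset_disk hz hu')).trans ?_
      have h0 := h.nonneg
      have := one_sub_norm_ge_half (mem_closedBall_iff_norm.1 hu')
      gcongr)
  refine h1.trans (le_of_eq ?_)
  field_simp
  ring

theorem one_sub_conj_mul_ne_zero {a b : ℂ} (ha : a ∈ disk) (hb : b ∈ disk) :
    1 - (starRingEnd ℂ) a * b ≠ 0 := by
  rw [mem_disk] at ha hb
  intro h
  have h1 : (starRingEnd ℂ) a * b = 1 := (sub_eq_zero.1 h).symm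
  have h2 := congrArg norm h1
  rw [norm_mul, RCLike.norm_conj, norm_one] at h2
  nlinarith [norm_nonneg a, norm_nonneg b]

theorem norm_one_sub_conj_mul_comm (a b : ℂ) :
    ‖1 - (starRingEnd ℂ) a * b‖ = ‖1 - (starRingEnd ℂ) b * a‖ := by
  rw [← RCLike.norm_conj (1 - (starRingEnd ℂ) a * b)]
  simp [mul_comm]

theorem pseudoHyp_eq (a b : ℂ) :
    pseudoHyp a b = ‖a - b‖ / ‖1 - (starRingEnd ℂ) a * b‖ := by
  rw [pseudoHyp, mobius, norm_div, norm_one_sub_conj_mul_comm, norm_sub_rev]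

theorem pseudoHyp_comm (a b : ℂ) : pseudoHyp a b = pseudoHyp b a := by
  rw [pseudoHyp_eq, pseudoHyp_eq, norm_one_sub_conj_mul_comm, norm_sub_rev]

theorem one_sub_conj_mul_eq (a b : ℂ) :
    1 - (starRingEnd ℂ) a * b = (1 - ‖a‖ ^ 2 : ℝ) + (starRingEnd ℂ) a * (a - b) := by
  have := Complex.conj_mul' a
  push_cast
  rw [← this]
  ring

/-- The function `(1 - |z|²) f'(z)` is Lipschitz in the pseudo-hyperbolic distance if `f` is a
Bloch function. -/
theorem BlochBound.sub_le {M : ℝ} {f : ℂ → ℂ} (hf : DifferentiableOn ℂ f disk)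
    (h : BlochBound M f) {a b : ℂ} (ha : a ∈ disk) (hb : b ∈ disk) :
    ‖(1 - ‖a‖ ^ 2 : ℝ) * deriv f a - (1 - ‖b‖ ^ 2 : ℝ) * deriv f b‖ ≤ 108 * M * pseudoHyp a b := by
  have hM := h.nonneg
  have hρ0 : 0 ≤ pseudoHyp a b := norm_nonneg _
  have key : ∀ u ∈ disk, ‖(1 - ‖u‖ ^ 2 : ℝ) * deriv f u‖ ≤ M := fun u hu => by
    rw [norm_mul, Complex.norm_real, Real.norm_of_nonneg (one_sub_norm_sq_pos hu).le]
    exact h u hu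
  -- For ρ ≥ 1/8 the trivial bound 2M ≤ 16Mρ suffices. For ρ < 1/8 the point b lies in the disc of
  -- radius d/2 about a, where the derivative estimates are available.
  rcases le_or_gt (1 / 8) (pseudoHyp a b) with hρ | hρ
  · refine (norm_sub_le _ _).trans ?_
    nlinarith [key a ha, key b hb, mul_le_mul_of_nonneg_left hρ hM]
  set ρ := pseudoHyp a b with hρdef
  have ha' := mem_disk.1 ha
  have hb' := mem_disk.1 hb
  set d := 1 - ‖a‖ with hd
  have hd0 : 0 < d := by linarith
  have h1 : ‖a - b‖ = ρ * ‖1 - (starRingEnd ℂ) a * b‖ := by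
    rw [hρdef, pseudoHyp_eq, div_mul_cancel₀]
    exact norm_ne_zero_iff.2 (one_sub_conj_mul_ne_zero ha hb)
  have h2 : ‖1 - (starRingEnd ℂ) a * b‖ ≤ 2 * d + ‖a - b‖ := by
    rw [one_sub_conj_mul_eq]
    refine (norm_add_le _ _).trans (add_le_add ?_ ?_)
    · rw [Complex.norm_real, Real.norm_of_nonneg (one_sub_norm_sq_pos ha).le]
      nlinarith [norm_nonneg a]
    · rw [norm_mul, RCLike.norm_conj]
      nlinarith [norm_nonneg (a - b)]
  -- The term ρ|a - b| on the right is absorbed, since ρ < 1/8; this leaves the factor 16/7 ≤ 3.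
  have h3 : ‖a - b‖ ≤ 3 * ρ * d := by
    have : ‖a - b‖ ≤ ρ * (2 * d + ‖a - b‖) := h1.le.trans (mul_le_mul_of_nonneg_left h2 hρ0)
    have h4 : ρ * ‖a - b‖ ≤ 1 / 8 * ‖a - b‖ := mul_le_mul_of_nonneg_right hρ.le (norm_nonneg _)
    nlinarith [mul_nonneg hρ0 hd0.le]
  have h4 : ‖a - b‖ ≤ d / 2 := by nlinarith
  have hball : Metric.closedBall a (d / 2) ⊆ disk := closedBall_half_subset_disk ha
  have hbm : b ∈ Metric.closedBall a (d / 2) := by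
    rw [mem_closedBall_iff_norm, norm_sub_rev]
    exact h4
  have h5 : ‖deriv f a - deriv f b‖ ≤ 16 * M / d ^ 2 * ‖a - b‖ := by
    refine (convex_closedBall a (d / 2)).norm_image_sub_le_of_norm_deriv_le (𝕜 := ℂ)
      (fun u hu => (hf.deriv isOpen_disk).differentiableAt (isOpen_disk.mem_nhds (hball hu)))
      (fun u hu => ?_) hbm (Metric.mem_closedBall_self (by linarith))
    refine (h.norm_deriv_deriv_le hf (hball hu)).trans ?_
    have h6 : d / 2 ≤ 1 - ‖u‖ := one_sub_norm_ge_half (mem_closedBall_iff_norm.1 hu)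
    calc 4 * M / (1 - ‖u‖) ^ 2 ≤ 4 * M / (d / 2) ^ 2 := by gcongr
      _ = 16 * M / d ^ 2 := by
        field_simp
        ring
  have h6 : d / 2 ≤ 1 - ‖b‖ := one_sub_norm_ge_half (mem_closedBall_iff_norm.1 hbm)
  have h7 : ‖deriv f b‖ ≤ M / (d / 2) :=
    (h.norm_deriv_le hb).trans (by gcongr)
  have h8 : |(1 - ‖a‖ ^ 2) - (1 - ‖b‖ ^ 2)| ≤ 2 * ‖a - b‖ := by
    have := abs_norm_sub_norm_le a b
    have h9 : (1 - ‖a‖ ^ 2) - (1 - ‖b‖ ^ 2) = -((‖a‖ + ‖b‖) * (‖a‖ - ‖b‖)) := by ring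
    rw [h9, abs_neg, abs_mul, abs_of_nonneg (by positivity)]
    exact mul_le_mul (by linarith) this (abs_nonneg _) (by norm_num)
  have h9 : (1 - ‖a‖ ^ 2 : ℝ) * deriv f a - (1 - ‖b‖ ^ 2 : ℝ) * deriv f b
      = (1 - ‖a‖ ^ 2 : ℝ) * (deriv f a - deriv f b)
        + (((1 - ‖a‖ ^ 2) - (1 - ‖b‖ ^ 2) : ℝ) : ℂ) * deriv f b := by
    push_cast
    ring
  rw [h9]
  refine (norm_add_le _ _).trans ?_
  rw [norm_mul, norm_mul, Complex.norm_real, Complex.norm_real, Real.norm_eq_abs, Real.norm_eq_abs,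
    abs_of_pos (one_sub_norm_sq_pos ha)]
  -- The two contributions are 96Mρ from the variation of f' and 12Mρ from the variation of the
  -- weight, which add up to 108Mρ.
  have e1 : (1 - ‖a‖ ^ 2) * ‖deriv f a - deriv f b‖ ≤ 2 * d * (16 * M / d ^ 2 * (3 * ρ * d)) := by
    refine mul_le_mul ?_ (h5.trans (by gcongr)) (norm_nonneg _) (by positivity)
    nlinarith [norm_nonneg a]
  have e2 : |(1 - ‖a‖ ^ 2) - (1 - ‖b‖ ^ 2)| * ‖deriv f b‖ ≤ 2 * (3 * ρ * d) * (M / (d / 2)) :=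
    mul_le_mul (h8.trans (by linarith)) h7 (norm_nonneg _) (by positivity)
  refine (add_le_add e1 e2).trans (le_of_eq ?_)
  field_simp
  ring

/-- A bound on the second derivative integrates to a Bloch bound. -/
theorem BlochBound.of_deriv_deriv {K : ℝ} (hK : 0 ≤ K) {f : ℂ → ℂ} (hf : DifferentiableOn ℂ f disk)
    (h : ∀ z ∈ disk, ‖deriv (deriv f) z‖ ≤ K / (1 - ‖z‖) ^ 2) :
    BlochBound (2 * (‖deriv f 0‖ + K)) f := by
  intro z hz
  have hz' := mem_disk.1 hz
  have hpos : ∀ t ∈ Icc (0 : ℝ) 1, 0 < 1 - t * ‖z‖ := fun t ht => by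
    nlinarith [ht.1, ht.2, norm_nonneg z]
  have hmem : ∀ t ∈ Icc (0 : ℝ) 1, (t : ℂ) * z ∈ disk := fun t ht => by
    rw [mem_disk, norm_mul, Complex.norm_real, Real.norm_of_nonneg ht.1]
    linarith [hpos t ht]
  have hd : ∀ t ∈ Icc (0 : ℝ) 1, HasDerivAt (fun t : ℝ => deriv f (t * z))
      (deriv (deriv f) (t * z) * z) t := fun t ht => by
    have h1 : HasDerivAt (deriv f) (deriv (deriv f) (t * z)) (t * z) :=
      ((hf.deriv isOpen_disk).differentiableAt (isOpen_disk.mem_nhds (hmem t ht))).hasDerivAt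
    have h2 : HasDerivAt (fun t : ℝ => (t : ℂ) * z) z t := by
      simpa using (Complex.ofRealCLM.hasDerivAt (x := t)).mul_const z
    exact h1.comp t h2
  have hB : ∀ t ∈ Icc (0 : ℝ) 1, HasDerivAt (fun t : ℝ => ‖deriv f 0‖ + K / (1 - t * ‖z‖))
      (K * ‖z‖ / (1 - t * ‖z‖) ^ 2) t := fun t ht => by
    have h1 : HasDerivAt (fun t : ℝ => 1 - t * ‖z‖) (-(1 * ‖z‖)) t :=
      ((hasDerivAt_id t).mul_const ‖z‖).const_sub 1
    have h2 := ((h1.inv (hpos t ht).ne').const_mul K).const_add ‖deriv f 0‖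
    refine h2.congr_deriv ?_
    ring
  -- Comparison along the segment from 0 to z: the derivative of the majorant B is the assumed bound
  -- on |z f''(tz)|, and at t = 0 the majorant exceeds |f'(0)| by K.
  have h1 := image_norm_le_of_norm_deriv_right_le_deriv_boundary' (a := 0) (b := 1)
    (f := fun t : ℝ => deriv f (t * z)) (f' := fun t : ℝ => deriv (deriv f) (t * z) * z)
    (B := fun t : ℝ => ‖deriv f 0‖ + K / (1 - t * ‖z‖))
    (B' := fun t : ℝ => K * ‖z‖ / (1 - t * ‖z‖) ^ 2)
    (fun t ht => (hd t ht).continuousAt.continuousWithinAt)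
    (fun t ht => (hd t (Ico_subset_Icc_self ht)).hasDerivWithinAt)
    (by simpa using hK)
    (fun t ht => (hB t ht).continuousAt.continuousWithinAt)
    (fun t ht => (hB t (Ico_subset_Icc_self ht)).hasDerivWithinAt)
    (fun t ht => by
      have ht' := Ico_subset_Icc_self ht
      rw [norm_mul]
      have h2 := h _ (hmem t ht')
      rw [norm_mul, Complex.norm_real, Real.norm_of_nonneg ht'.1] at h2
      calc _ ≤ K / (1 - t * ‖z‖) ^ 2 * ‖z‖ := mul_le_mul_of_nonneg_right h2 (norm_nonneg z)
        _ = _ := by ring)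
    (right_mem_Icc.2 zero_le_one)
  simp only [Complex.ofReal_one, one_mul] at h1
  have hz0 : 0 < 1 - ‖z‖ := by linarith
  have h2 : (1 - ‖z‖) * ‖deriv f z‖ ≤ ‖deriv f 0‖ + K := by
    calc _ ≤ (1 - ‖z‖) * (‖deriv f 0‖ + K / (1 - ‖z‖)) := mul_le_mul_of_nonneg_left h1 hz0.le
      _ = (1 - ‖z‖) * ‖deriv f 0‖ + K := by
        field_simp
      _ ≤ _ := by nlinarith [norm_nonneg z, norm_nonneg (deriv f 0)]
  have h3 : 0 ≤ (1 - ‖z‖) * ‖deriv f z‖ := by positivity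
  calc (1 - ‖z‖ ^ 2) * ‖deriv f z‖ = (1 + ‖z‖) * ((1 - ‖z‖) * ‖deriv f z‖) := by ring
    _ ≤ 2 * (‖deriv f 0‖ + K) := mul_le_mul (by linarith) h2 h3 (by norm_num)

/-- A function that differs by at most `S` from a constant on the disk is a Bloch function. -/
theorem BlochBound.of_norm_sub_const_le {S : ℝ} {f : ℂ → ℂ} {c : ℂ}
    (hf : DifferentiableOn ℂ f disk) (h : ∀ z ∈ disk, ‖f z - c‖ ≤ S) :
    BlochBound (4 * S) f := by
  intro z hz
  have hz' := mem_disk.1 hz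
  have hd : 0 < (1 - ‖z‖) / 2 := by linarith
  have h1 := Complex.norm_deriv_le_of_forall_mem_sphere_norm_le (f := fun u => f u - c) hd
    (((hf.sub_const c).mono (closedBall_half_subset_disk hz)).diffContOnCl_ball subset_rfl)
    (fun u hu => h u (closedBall_half_subset_disk hz (Metric.sphere_subset_closedBall hu)))
  rw [deriv_sub_const] at h1
  rw [le_div_iff₀ hd] at h1
  nlinarith [norm_nonneg z, norm_nonneg (deriv f z),
    mul_nonneg (mul_nonneg (sub_nonneg.2 hz'.le) (sub_nonneg.2 hz'.le)) (norm_nonneg (deriv f z))]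

/-! ### The submean value property over discs -/

/-- The indicator stays inside the angular integral, so the radial domain does not depend on r and
two such integrals can be compared circle by circle. -/
theorem setLIntegral_ball_eq_polar (c : ℂ) (r : ℝ) {F : ℂ → ℝ≥0∞} (hF : Measurable F) :
    ∫⁻ u in Metric.ball c r, F u = ∫⁻ ρ in Ioi (0 : ℝ), ENNReal.ofReal ρ *
      ∫⁻ θ in Ioo (-Real.pi) Real.pi,
        (Metric.ball c r).indicator F (circleMap c ρ θ) := by
  have hG : Measurable ((Metric.ball c r).indicator F) := hF.indicator Metric.isOpen_ball.measurableSet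
  rw [← lintegral_indicator Metric.isOpen_ball.measurableSet,
    ← lintegral_add_left_eq_self _ c, ← Complex.lintegral_comp_polarCoord_symm,
    polarCoord_target, Measure.volume_eq_prod, ← Measure.prod_restrict, lintegral_prod]
  · refine lintegral_congr fun ρ => ?_
    rw [← lintegral_const_mul]
    · refine lintegral_congr fun θ => ?_
      rw [Complex.polarCoord_symm_apply, smul_eq_mul, circleMap, Complex.exp_mul_I]
      simp
    · exact hG.comp (by fun_prop)
  · refine Measurable.aemeasurable (Measurable.mul (by fun_prop) (hG.comp ?_))
    have h : ⇑Complex.polarCoord.symm = fun p : ℝ × ℝ =>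
        (p.1 : ℂ) * (Real.cos p.2 + Real.sin p.2 * Complex.I) :=
      funext Complex.polarCoord_symm_apply
    rw [h]
    fun_prop

/-- The mean value property on one circle, with the angle shifted to (-π, π) to match polar
coordinates. -/
theorem two_pi_mul_enorm_le {g : ℂ → ℂ} {c : ℂ} {ρ r : ℝ} (hρ : 0 < ρ) (hr : ρ < r)
    (hg : DifferentiableOn ℂ g (Metric.ball c r)) :
    ENNReal.ofReal (2 * Real.pi) * ‖g c‖ₑ ≤
      ∫⁻ θ in Ioo (-Real.pi) Real.pi, ‖g (circleMap c ρ θ)‖ₑ := by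
  have h1 : Real.circleAverage g c ρ = g c := by
    refine DiffContOnCl.circleAverage ?_
    rw [abs_of_pos hρ]
    exact (hg.mono (Metric.closedBall_subset_ball hr)).diffContOnCl_ball subset_rfl
  rw [Real.circleAverage_eq_integral_add (-Real.pi),
    intervalIntegral.integral_comp_add_right (fun θ ↦ g (circleMap c ρ θ))] at h1
  have h2 : (2 * Real.pi : ℝ) • g c = ∫ θ in (-Real.pi)..Real.pi, g (circleMap c ρ θ) := by
    rw [← h1, smul_smul, mul_inv_cancel₀ (by positivity), one_smul]
    congr 1 <;> ring
  have h3 : ENNReal.ofReal (2 * Real.pi) * ‖g c‖ₑ = ‖(2 * Real.pi : ℝ) • g c‖ₑ := by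
    rw [enorm_smul, Real.enorm_eq_ofReal (by positivity)]
  rw [h3, h2, intervalIntegral.integral_of_le (by linarith [Real.pi_pos]),
    integral_Ioc_eq_integral_Ioo]
  exact enorm_integral_le_lintegral_enorm _

/-- The submean value property over a disc. -/
theorem area_mul_enorm_le {g : ℂ → ℂ} (hgm : Measurable g) {c : ℂ} {r : ℝ}
    (hg : DifferentiableOn ℂ g (Metric.ball c r)) :
    volume (Metric.ball c r) * ‖g c‖ₑ ≤ ∫⁻ u in Metric.ball c r, ‖g u‖ₑ := by
  have h0 : volume (Metric.ball c r) * ‖g c‖ₑ = ∫⁻ _ in Metric.ball c r, ‖g c‖ₑ := by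
    rw [setLIntegral_const, mul_comm]
  rw [h0, setLIntegral_ball_eq_polar c r measurable_const,
    setLIntegral_ball_eq_polar c r hgm.enorm]
  refine setLIntegral_mono' measurableSet_Ioi fun ρ hρ => ?_
  refine mul_le_mul' le_rfl ?_
  rcases lt_or_ge ρ r with h | h
  · have hm : ∀ θ, circleMap c ρ θ ∈ Metric.ball c r := fun θ =>
      Metric.sphere_subset_closedBall.trans (Metric.closedBall_subset_ball h)
        (circleMap_mem_sphere c (le_of_lt hρ) θ)
    have hi : ∀ (F : ℂ → ℝ≥0∞) θ, (Metric.ball c r).indicator F (circleMap c ρ θ)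
        = F (circleMap c ρ θ) := fun F θ => indicator_of_mem (hm θ) F
    simp only [hi]
    refine le_trans (le_of_eq ?_) (two_pi_mul_enorm_le hρ h hg)
    rw [setLIntegral_const, Real.volume_Ioo, mul_comm]
    congr 2
    ring
  · have hm : ∀ θ, circleMap c ρ θ ∉ Metric.ball c r := fun θ hθ =>
      circleMap_notMem_ball c ρ θ (Metric.ball_subset_ball h hθ)
    have hi : ∀ (F : ℂ → ℝ≥0∞) θ, (Metric.ball c r).indicator F (circleMap c ρ θ) = 0 :=
      fun F θ => indicator_of_notMem (hm θ) F
    simp only [hi]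
    exact le_rfl

/-- The case of exponent 1 combined with Hölder's inequality on the disc; after raising to the power
p, a common factor V^(p-1) of the area V cancels. -/
theorem area_mul_enorm_rpow_le {p : ℝ} (hp : 1 ≤ p) {g : ℂ → ℂ} (hgm : Measurable g) {c : ℂ} {r : ℝ}
    (hr : 0 < r) (hg : DifferentiableOn ℂ g (Metric.ball c r)) :
    volume (Metric.ball c r) * ‖g c‖ₑ ^ p ≤ ∫⁻ u in Metric.ball c r, ‖g u‖ₑ ^ p := by
  have h1 := area_mul_enorm_le hgm hg
  have h2 := eLpNorm'_le_eLpNorm'_mul_rpow_measure_univ (μ := volume.restrict (Metric.ball c r))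
    (f := g) one_pos hp hgm.aestronglyMeasurable
  have hp0 : 0 < p := by linarith
  simp only [eLpNorm', ENNReal.rpow_one, div_one, Measure.restrict_apply_univ] at h2
  set V := volume (Metric.ball c r) with hV
  have hV0 : V ≠ 0 := (Metric.measure_ball_pos _ _ hr).ne'
  have hVt : V ≠ ∞ := measure_ball_lt_top.ne
  have h3 := ENNReal.rpow_le_rpow (h1.trans h2) hp0.le
  rw [ENNReal.mul_rpow_of_nonneg _ _ hp0.le, ENNReal.mul_rpow_of_nonneg _ _ hp0.le,
    ← ENNReal.rpow_mul, ← ENNReal.rpow_mul, one_div_mul_cancel hp0.ne', ENNReal.rpow_one] at h3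
  have h4 : V ^ p = V ^ ((1 - 1 / p) * p) * V := by
    conv_rhs => rw [← ENNReal.rpow_one V, ← ENNReal.rpow_mul, one_mul]
    rw [← ENNReal.rpow_add _ _ hV0 hVt]
    congr 1
    field_simp
    ring
  have h5 : V ^ ((1 - 1 / p) * p) ≠ 0 := by
    simp [ENNReal.rpow_eq_zero_iff, hV0, hVt]
  have h6 : V ^ ((1 - 1 / p) * p) ≠ ∞ := by
    simp [ENNReal.rpow_eq_top_iff, hV0, hVt]
  rw [h4, mul_comm (∫⁻ u in Metric.ball c r, ‖g u‖ₑ ^ p), mul_assoc] at h3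
  exact (ENNReal.mul_le_mul_iff_right h5 h6).1 h3

theorem diskArea_restrict {s : Set ℂ} (hs : MeasurableSet s) (h : s ⊆ disk) :
    diskArea.restrict s = (ENNReal.ofReal Real.pi)⁻¹ • volume.restrict s := by
  rw [diskArea, Measure.restrict_smul, Measure.restrict_restrict hs, inter_eq_left.2 h]

theorem sq_mul_enorm_rpow_le {p : ℝ} (hp : 1 ≤ p) {g : ℂ → ℂ} (hgm : Measurable g)
    (hg : DifferentiableOn ℂ g disk) {c : ℂ} {r : ℝ} (hr : 0 < r) (h : Metric.ball c r ⊆ disk) :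
    ENNReal.ofReal (r ^ 2) * ‖g c‖ₑ ^ p ≤ ∫⁻ u in Metric.ball c r, ‖g u‖ₑ ^ p ∂diskArea := by
  have h1 := area_mul_enorm_rpow_le hp hgm hr (hg.mono h)
  rw [diskArea_restrict Metric.isOpen_ball.measurableSet h, lintegral_smul_measure, smul_eq_mul]
  refine le_trans (le_of_eq ?_) (mul_le_mul' le_rfl h1)
  have hpi : (NNReal.pi : ℝ≥0∞) = ENNReal.ofReal Real.pi := by
    rw [← NNReal.coe_real_pi, ENNReal.ofReal_coe_nnreal]
  rw [Complex.volume_ball, hpi, ← mul_assoc, mul_comm (ENNReal.ofReal r ^ 2), ← mul_assoc,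
    ENNReal.inv_mul_cancel (by simp [Real.pi_pos]) ENNReal.ofReal_ne_top, one_mul,
    ENNReal.ofReal_pow hr.le]

theorem ball_half_subset_disk {z : ℂ} (hz : z ∈ disk) :
    Metric.ball z ((1 - ‖z‖) / 2) ⊆ disk :=
  Metric.ball_subset_closedBall.trans (closedBall_half_subset_disk hz)

/-! ### Besov functions are Bloch functions -/

/-- The submean value property of f'' on the disc of radius (1 - |z|)/2 gives |f''(z)| ≤ 4 ∫|f''| dA
/ (1 - |z|)², which then integrates to a Bloch bound. -/
theorem exists_blochBound_of_secondIntegral {f : ℂ → ℂ} (hf : DifferentiableOn ℂ f disk)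
    (h : secondIntegral f < ∞) : ∃ M, BlochBound M f := by
  refine ⟨_, BlochBound.of_deriv_deriv (K := 4 * (secondIntegral f).toReal) (by positivity) hf
    fun z hz => ?_⟩
  have hz' := mem_disk.1 hz
  have hd : 0 < 1 - ‖z‖ := by linarith
  have h1 := sq_mul_enorm_rpow_le le_rfl (measurable_deriv (deriv f))
    ((hf.deriv isOpen_disk).deriv isOpen_disk) (half_pos hd) (ball_half_subset_disk hz)
  simp only [ENNReal.rpow_one] at h1
  have h2 : ENNReal.ofReal (((1 - ‖z‖) / 2) ^ 2) * ‖deriv (deriv f) z‖ₑ ≤ secondIntegral f :=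
    h1.trans (setLIntegral_le_lintegral _ _)
  have h3 := ENNReal.toReal_mono h.ne h2
  rw [ENNReal.toReal_mul, ENNReal.toReal_ofReal (by positivity), toReal_enorm] at h3
  rw [le_div_iff₀ (by positivity)]
  nlinarith

/-- On this disc 1 - |u|² lies between (1 - |z|)/3 and 3(1 - |z|). The exponent -|q| covers both
signs of q at once. -/
theorem rpow_one_sub_norm_sq_ge (q : ℝ) {z u : ℂ} (hz : z ∈ disk)
    (hu : u ∈ Metric.ball z ((1 - ‖z‖) / 2)) :
    3 ^ (-|q|) * (1 - ‖z‖) ^ q ≤ (1 - ‖u‖ ^ 2) ^ q := by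
  have hz' := mem_disk.1 hz
  have hd : 0 < 1 - ‖z‖ := by linarith
  have hu' := mem_disk.1 (ball_half_subset_disk hz hu)
  have hu1 := (mem_ball_iff_norm.1 hu).le
  have h1 := one_sub_norm_ge_half hu1
  have h2 : ‖z‖ ≤ ‖u‖ + ‖u - z‖ := by
    have := norm_sub_le u (u - z)
    simpa using this
  have h3 : (1 - ‖z‖) / 3 ≤ 1 - ‖u‖ ^ 2 := by nlinarith [norm_nonneg u]
  have h4 : 1 - ‖u‖ ^ 2 ≤ 3 * (1 - ‖z‖) := by nlinarith [norm_nonneg u]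
  rcases le_or_gt 0 q with hq | hq
  · rw [abs_of_nonneg hq, Real.rpow_neg (by norm_num), ← Real.inv_rpow (by norm_num),
      ← Real.mul_rpow (by norm_num) hd.le]
    exact Real.rpow_le_rpow (by positivity) (by linarith) hq
  · rw [abs_of_neg hq, neg_neg, ← Real.mul_rpow (by norm_num) hd.le]
    exact Real.rpow_le_rpow_of_nonpos (by linarith) h4 hq.le

/-- Submean value property for |f'|^p on the disc of radius (1 - |z|)/2, where the weight is
essentially constant: the area (1 - |z|)² times the weight (1 - |z|)^(p-2) is exactly (1 - |z|)^p.
-/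
theorem BlochBound.of_besovIntegral_le {p : ℝ} (hp : 1 ≤ p) {f : ℂ → ℂ}
    (hf : DifferentiableOn ℂ f disk) {M : ℝ} (hM : 0 ≤ M)
    (h : besovIntegral p f ^ (1 / p) ≤ ENNReal.ofReal M) :
    BlochBound (2 * (4 * 3 ^ |p - 2| * M)) f := by
  intro z hz
  have hp0 : 0 < p := by linarith
  have hz' := mem_disk.1 hz
  have hd : 0 < 1 - ‖z‖ := by linarith
  have h1 : besovIntegral p f ≤ ENNReal.ofReal (M ^ p) := by
    have := ENNReal.rpow_le_rpow h hp0.le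
    rwa [← ENNReal.rpow_mul, one_div_mul_cancel hp0.ne', ENNReal.rpow_one,
      ENNReal.ofReal_rpow_of_nonneg hM hp0.le] at this
  have h2 : ENNReal.ofReal (((1 - ‖z‖) / 2) ^ 2) * ‖deriv f z‖ₑ ^ p
      * ENNReal.ofReal (3 ^ (-|p - 2|) * (1 - ‖z‖) ^ (p - 2)) ≤ besovIntegral p f := by
    refine (mul_le_mul' (sq_mul_enorm_rpow_le hp (measurable_deriv f) (hf.deriv isOpen_disk)
      (half_pos hd) (ball_half_subset_disk hz)) le_rfl).trans ?_
    rw [← lintegral_mul_const _ ((measurable_deriv f).enorm.pow_const p)]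
    refine le_trans ?_ (setLIntegral_le_lintegral (Metric.ball z ((1 - ‖z‖) / 2)) _)
    refine setLIntegral_mono' Metric.isOpen_ball.measurableSet fun u hu => ?_
    exact mul_le_mul' le_rfl (ENNReal.ofReal_le_ofReal (rpow_one_sub_norm_sq_ge _ hz hu))
  have h3 := h2.trans h1
  rw [← ofReal_norm, ENNReal.ofReal_rpow_of_nonneg (norm_nonneg _) hp0.le,
    ← ENNReal.ofReal_mul (by positivity), ← ENNReal.ofReal_mul (by positivity),
    ENNReal.ofReal_le_ofReal_iff (by positivity)] at h3
  have hC : (1 : ℝ) ≤ 4 * 3 ^ |p - 2| := by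
    have := Real.one_le_rpow (show (1 : ℝ) ≤ 3 by norm_num) (abs_nonneg (p - 2))
    linarith
  set C : ℝ := 4 * 3 ^ |p - 2| with hCdef
  have h4 : ((1 - ‖z‖) * ‖deriv f z‖) ^ p ≤ (C * M) ^ p := by
    rw [Real.mul_rpow hd.le (norm_nonneg _), Real.mul_rpow (by linarith) hM]
    have e1 : (1 - ‖z‖) ^ p = (1 - ‖z‖) ^ (p - 2) * (1 - ‖z‖) ^ 2 := by
      rw [← Real.rpow_natCast, ← Real.rpow_add hd]
      norm_num
    -- Since C ≥ 1, it may be replaced by C^p, so that the p-th root leaves a constant C linear in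
    -- front of M.
    have e2 : C ≤ C ^ p := by
      conv_lhs => rw [← Real.rpow_one C]
      exact Real.rpow_le_rpow_of_exponent_le hC hp
    have e3 : (3 : ℝ) ^ (-|p - 2|) * 3 ^ |p - 2| = 1 := by
      rw [← Real.rpow_add (by norm_num)]
      simp
    calc (1 - ‖z‖) ^ p * ‖deriv f z‖ ^ p
        = ((1 - ‖z‖) ^ (p - 2) * (1 - ‖z‖) ^ 2 * ‖deriv f z‖ ^ p)
            * (3 ^ (-|p - 2|) * 3 ^ |p - 2|) := by rw [e1, e3, mul_one]
      _ = C * (((1 - ‖z‖) / 2) ^ 2 * ‖deriv f z‖ ^ p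
            * (3 ^ (-|p - 2|) * (1 - ‖z‖) ^ (p - 2))) := by
        rw [hCdef]
        ring
      _ ≤ C ^ p * M ^ p := by gcongr
  have h5 : (1 - ‖z‖) * ‖deriv f z‖ ≤ C * M :=
    (Real.rpow_le_rpow_iff (by positivity) (by positivity) hp0).1 h4
  nlinarith [norm_nonneg z, mul_nonneg hd.le (norm_nonneg (deriv f z))]

theorem norm_one_sub_conj_mul_sq_sub (w z : ℂ) :
    ‖1 - (starRingEnd ℂ) w * z‖ ^ 2 - ‖w - z‖ ^ 2 = (1 - ‖w‖ ^ 2) * (1 - ‖z‖ ^ 2) := by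
  simp only [Complex.sq_norm, Complex.normSq_apply, Complex.sub_re, Complex.sub_im, Complex.mul_re,
    Complex.mul_im, Complex.conj_re, Complex.conj_im, Complex.one_re, Complex.one_im]
  ring

theorem norm_mobius_le_one {w z : ℂ} (hw : w ∈ disk) (hz : z ∈ disk) : ‖mobius w z‖ ≤ 1 := by
  have h0 := one_sub_conj_mul_ne_zero hw hz
  rw [mobius, norm_div, div_le_one (norm_pos_iff.2 h0)]
  have h1 : ‖w - z‖ ^ 2 ≤ ‖1 - (starRingEnd ℂ) w * z‖ ^ 2 := by
    have := mul_pos (one_sub_norm_sq_pos hw) (one_sub_norm_sq_pos hz)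
    rw [← norm_one_sub_conj_mul_sq_sub] at this
    linarith
  exact (sq_le_sq₀ (norm_nonneg _) (norm_nonneg _)).1 h1

theorem IsAtomicDecomp.norm_sub_le {f : ℂ → ℂ} {c w : ℕ → ℂ} (h : IsAtomicDecomp f c w) {z : ℂ}
    (hz : z ∈ disk) : ‖f z - c 0‖ ≤ ∑' j, ‖c j‖ := by
  have hs := (summable_nat_add_iff 1).2 h.summable
  have h1 : ‖f z - c 0‖ ≤ ∑' j, ‖c (j + 1)‖ := by
    refine (h.hasSum z hz).norm_le_of_bounded hs.hasSum fun j => ?_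
    rw [norm_mul]
    exact mul_le_of_le_one_right (norm_nonneg _) (norm_mobius_le_one (h.mem j) hz)
  rw [h.summable.tsum_eq_zero_add]
  linarith [norm_nonneg (c 0)]

theorem BlochBound.of_atomicNorm_lt {f : ℂ → ℂ} (hf : DifferentiableOn ℂ f disk) {M : ℝ}
    (h : atomicNorm f < ENNReal.ofReal M) : BlochBound (4 * M) f := by
  simp only [atomicNorm, iInf_lt_iff] at h
  obtain ⟨c, w, hcw, h⟩ := h
  refine BlochBound.of_norm_sub_const_le hf fun z hz => (hcw.norm_sub_le hz).trans ?_
  have h1 : ∑' j, ‖c j‖ₑ = ENNReal.ofReal (∑' j, ‖c j‖) := by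
    rw [ENNReal.ofReal_tsum_of_nonneg (fun _ => norm_nonneg _) hcw.summable]
    simp only [ofReal_norm]
  rw [h1] at h
  exact (ENNReal.ofReal_lt_ofReal_iff'.1 h).1.le

/-- The quantitative embedding: C depends on p only. The strict inequality allows M to be any number
above the norm, so the infimum in the atomic norm need not be attained. -/
theorem exists_blochBound_of_besovNorm (p : ℝ) (hp : 1 ≤ p) :
    ∃ C > 0, ∀ f, DifferentiableOn ℂ f disk → ∀ M, 0 < M → besovNorm p f < ENNReal.ofReal M →
      BlochBound (C * M) f := by
  by_cases h : p = 1
  · refine ⟨4, by norm_num, fun f hf M _ hM => ?_⟩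
    rw [besovNorm, if_pos h] at hM
    exact BlochBound.of_atomicNorm_lt hf hM
  · refine ⟨2 * (4 * 3 ^ |p - 2|), by positivity, fun f hf M hM0 hM => ?_⟩
    rw [besovNorm, if_neg h] at hM
    have := BlochBound.of_besovIntegral_le hp hf hM0.le (le_add_self.trans hM.le)
    rwa [← mul_assoc] at this

theorem exists_blochBound_of_mem {p : ℝ} [hp : Fact (1 ≤ p)] {f : ℂ → ℂ}
    (hf : f ∈ besovSubmodule p) : ∃ M, BlochBound M f := by
  obtain ⟨hf1, hf2⟩ := hf
  have hp0 : (0 : ℝ) < 1 / p := by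
    have := hp.out
    positivity
  split_ifs at hf2 with h
  · exact exists_blochBound_of_secondIntegral hf1.1 hf2
  · refine ⟨_, BlochBound.of_besovIntegral_le hp.out hf1.1
      (M := (besovIntegral p f ^ (1 / p)).toReal) ENNReal.toReal_nonneg ?_⟩
    rw [ENNReal.ofReal_toReal]
    exact (ENNReal.rpow_lt_top_of_nonneg hp0.le hf2.ne).ne

/-! ### The difference operator on Bloch functions -/

section

variable {ν : ℂ → ℝ} {φ ψ f : ℂ → ℂ} {M : ℝ}

/-- The function `f ∘ φ - f ∘ ψ` on the disk, extended by zero. -/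
noncomputable def diffComp (φ ψ f : ℂ → ℂ) : ℂ → ℂ := disk.indicator fun z => f (φ z) - f (ψ z)

theorem diffComp_of_mem {z : ℂ} (hz : z ∈ disk) : diffComp φ ψ f z = f (φ z) - f (ψ z) :=
  indicator_of_mem hz _

theorem zero_mem_disk : (0 : ℂ) ∈ disk := by simp [mem_disk]

theorem diffComp_add (φ ψ f g : ℂ → ℂ) :
    diffComp φ ψ (f + g) = diffComp φ ψ f + diffComp φ ψ g := by
  funext z
  by_cases hz : z ∈ disk
  · simp only [Pi.add_apply, diffComp_of_mem hz]
    ring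
  · simp [diffComp, hz]

theorem diffComp_smul (φ ψ f : ℂ → ℂ) (c : ℂ) : diffComp φ ψ (c • f) = c • diffComp φ ψ f := by
  funext z
  by_cases hz : z ∈ disk
  · simp only [Pi.smul_apply, smul_eq_mul, diffComp_of_mem hz]
    ring
  · simp [diffComp, hz]

theorem diffComp_sub (φ ψ f g : ℂ → ℂ) :
    diffComp φ ψ (f - g) = diffComp φ ψ f - diffComp φ ψ g := by
  rw [sub_eq_add_neg, ← neg_one_smul ℂ g, diffComp_add, diffComp_smul, neg_one_smul,
    ← sub_eq_add_neg]

theorem hasDerivAt_diffComp (hφ : DifferentiableOn ℂ φ disk) (hφm : MapsTo φ disk disk)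
    (hψ : DifferentiableOn ℂ ψ disk) (hψm : MapsTo ψ disk disk) (hf : DifferentiableOn ℂ f disk)
    {z : ℂ} (hz : z ∈ disk) :
    HasDerivAt (diffComp φ ψ f)
      (deriv f (φ z) * deriv φ z - deriv f (ψ z) * deriv ψ z) z := by
  have hd : ∀ {g : ℂ → ℂ}, DifferentiableOn ℂ g disk → ∀ {u}, u ∈ disk →
      HasDerivAt g (deriv g u) u := fun hg u hu =>
    (hg.differentiableAt (isOpen_disk.mem_nhds hu)).hasDerivAt
  refine (((hd hf (hφm hz)).comp z (hd hφ hz)).sub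
    ((hd hf (hψm hz)).comp z (hd hψ hz))).congr_of_eventuallyEq ?_
  filter_upwards [isOpen_disk.mem_nhds hz] with u hu using diffComp_of_mem hu

theorem diffComp_mem_holoDisk (hφ : DifferentiableOn ℂ φ disk) (hφm : MapsTo φ disk disk)
    (hψ : DifferentiableOn ℂ ψ disk) (hψm : MapsTo ψ disk disk)
    (hf : DifferentiableOn ℂ f disk) : diffComp φ ψ f ∈ holoDisk :=
  ⟨fun _ hz => (hasDerivAt_diffComp hφ hφm hψ hψm hf hz).differentiableAt.differentiableWithinAt,
    fun _ hz => indicator_of_notMem hz _⟩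

/-- The quantity that must vanish at the boundary in the first condition. -/
noncomputable def distortion (ν : ℂ → ℝ) (φ ψ : ℂ → ℂ) (z : ℂ) : ℝ :=
  max (‖deriv φ z‖ / (1 - ‖φ z‖ ^ 2)) (‖deriv ψ z‖ / (1 - ‖ψ z‖ ^ 2))
    * ν z * pseudoHyp (φ z) (ψ z)

/-- The quantity that must vanish at the boundary in the second condition. -/
noncomputable def hypDerivDiff (ν : ℂ → ℝ) (φ ψ : ℂ → ℂ) (z : ℂ) : ℝ :=
  ‖(ν z : ℂ) * deriv φ z / (1 - ‖φ z‖ ^ 2) - (ν z : ℂ) * deriv ψ z / (1 - ‖ψ z‖ ^ 2)‖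

/-- The splitting A (F(φ) - F(ψ)) + (A - B) F(ψ), with F(u) = (1 - |u|²) f'(u). The Lipschitz bound
on F treats the first term and |F| ≤ M the second. -/
theorem BlochBound.mul_norm_deriv_diffComp_le (h : BlochBound M f)
    (hν : ∀ z ∈ disk, 0 < ν z) (hφ : DifferentiableOn ℂ φ disk) (hφm : MapsTo φ disk disk)
    (hψ : DifferentiableOn ℂ ψ disk) (hψm : MapsTo ψ disk disk) (hf : DifferentiableOn ℂ f disk)
    {z : ℂ} (hz : z ∈ disk) :
    ν z * ‖deriv (diffComp φ ψ f) z‖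
      ≤ M * (108 * distortion ν φ ψ z + hypDerivDiff ν φ ψ z) := by
  rw [(hasDerivAt_diffComp hφ hφm hψ hψm hf hz).deriv]
  have hM := h.nonneg
  have ha := one_sub_norm_sq_pos (hφm hz)
  have hb := one_sub_norm_sq_pos (hψm hz)
  have ha' : (1 - (‖φ z‖ : ℂ) ^ 2) ≠ 0 := by exact_mod_cast ha.ne'
  have hb' : (1 - (‖ψ z‖ : ℂ) ^ 2) ≠ 0 := by exact_mod_cast hb.ne'
  have e : (ν z : ℂ) * (deriv f (φ z) * deriv φ z - deriv f (ψ z) * deriv ψ z)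
      = (ν z : ℂ) * deriv φ z / (1 - ‖φ z‖ ^ 2) * ((1 - ‖φ z‖ ^ 2 : ℝ) * deriv f (φ z)
          - (1 - ‖ψ z‖ ^ 2 : ℝ) * deriv f (ψ z))
        + ((ν z : ℂ) * deriv φ z / (1 - ‖φ z‖ ^ 2) - (ν z : ℂ) * deriv ψ z / (1 - ‖ψ z‖ ^ 2))
          * ((1 - ‖ψ z‖ ^ 2 : ℝ) * deriv f (ψ z)) := by
    push_cast
    field_simp
    ring
  have e1 : ν z * ‖deriv f (φ z) * deriv φ z - deriv f (ψ z) * deriv ψ z‖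
      = ‖(ν z : ℂ) * (deriv f (φ z) * deriv φ z - deriv f (ψ z) * deriv ψ z)‖ := by
    rw [norm_mul, Complex.norm_real, Real.norm_of_nonneg (hν z hz).le]
  rw [e1, e]
  refine (norm_add_le _ _).trans ?_
  rw [norm_mul, norm_mul, mul_add]
  have h1 : ‖(ν z : ℂ) * deriv φ z / (1 - ‖φ z‖ ^ 2)‖
      = ‖deriv φ z‖ / (1 - ‖φ z‖ ^ 2) * ν z := by
    have : (1 - (‖φ z‖ : ℂ) ^ 2) = ((1 - ‖φ z‖ ^ 2 : ℝ) : ℂ) := by push_cast; rfl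
    rw [this, norm_div, norm_mul, Complex.norm_real, Complex.norm_real,
      Real.norm_of_nonneg (hν z hz).le, Real.norm_of_nonneg ha.le]
    ring
  have h2 : ‖((1 - ‖ψ z‖ ^ 2 : ℝ) : ℂ) * deriv f (ψ z)‖ ≤ M := by
    rw [norm_mul, Complex.norm_real, Real.norm_of_nonneg hb.le]
    exact h _ (hψm hz)
  have hρ : 0 ≤ pseudoHyp (φ z) (ψ z) := norm_nonneg _
  refine add_le_add ?_ ?_
  · rw [h1]
    calc _ ≤ max (‖deriv φ z‖ / (1 - ‖φ z‖ ^ 2)) (‖deriv ψ z‖ / (1 - ‖ψ z‖ ^ 2)) * ν z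
            * (108 * M * pseudoHyp (φ z) (ψ z)) := by
          have h3 := (hν z hz).le
          refine mul_le_mul (mul_le_mul_of_nonneg_right (le_max_left _ _) h3)
            (h.sub_le hf (hφm hz) (hψm hz)) (norm_nonneg _) ?_
          exact mul_nonneg (le_max_of_le_left (by positivity)) h3
      _ = _ := by
          rw [distortion]
          ring
  · rw [mul_comm M]
    exact mul_le_mul_of_nonneg_left h2 (norm_nonneg _)

theorem toCircle_hasBasis :
    toCircle.HasBasis (fun r : ℝ => r < 1) fun r => {z : ℂ | r < ‖z‖ ∧ ‖z‖ < 1} :=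
  (nhdsLT_basis (1 : ℝ)).comap _

theorem exists_radius_of_tendsto {F : ℂ → ℝ} (h : Tendsto F toCircle (𝓝 0)) {ε : ℝ} (hε : 0 < ε) :
    ∃ r < 1, ∀ z ∈ disk, r < ‖z‖ → F z < ε := by
  obtain ⟨r, hr, h⟩ := toCircle_hasBasis.eventually_iff.1 (h.eventually (gt_mem_nhds hε))
  exact ⟨r, hr, fun z hz hrz => h ⟨hrz, mem_disk.1 hz⟩⟩

theorem closedBall_subset_disk {r : ℝ} (hr : r < 1) : Metric.closedBall (0 : ℂ) r ⊆ disk :=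
  Metric.closedBall_subset_ball hr

/-- On a smaller disc, `ν (|φ'| + |ψ'|)` is bounded. -/
theorem exists_bound_weight_mul_deriv (hν : ContinuousOn ν disk) (hφ : DifferentiableOn ℂ φ disk)
    (hψ : DifferentiableOn ℂ ψ disk) {r : ℝ} (hr : r < 1) :
    ∃ Q > 0, ∀ z ∈ Metric.closedBall (0 : ℂ) r, ν z * (‖deriv φ z‖ + ‖deriv ψ z‖) ≤ Q := by
  have hc : ContinuousOn (fun z => ν z * (‖deriv φ z‖ + ‖deriv ψ z‖)) disk :=
    hν.mul ((hφ.deriv isOpen_disk).continuousOn.norm.add (hψ.deriv isOpen_disk).continuousOn.norm)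
  obtain ⟨Q, hQ⟩ := (isCompact_closedBall (0 : ℂ) r).bddAbove_image
    (hc.mono (closedBall_subset_disk hr))
  exact ⟨max Q 1, by positivity, fun z hz => (hQ (mem_image_of_mem _ hz)).trans (le_max_left _ _)⟩

theorem exists_radius_image (hφ : DifferentiableOn ℂ φ disk) (hφm : MapsTo φ disk disk) {r : ℝ}
    (hr : r < 1) : ∃ s < 1, ∀ z ∈ Metric.closedBall (0 : ℂ) r, ‖φ z‖ ≤ s := by
  rcases (Metric.closedBall (0 : ℂ) r).eq_empty_or_nonempty with h | h
  · exact ⟨0, zero_lt_one, by simp [h]⟩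
  obtain ⟨z, hz, hmax⟩ := (isCompact_closedBall (0 : ℂ) r).exists_isMaxOn h
    ((hφ.continuousOn.mono (closedBall_subset_disk hr)).norm)
  exact ⟨‖φ z‖, mem_disk.1 (hφm (closedBall_subset_disk hr hz)), fun u hu => hmax hu⟩

theorem norm_deriv_diffComp_le_of_le (hν : ∀ z ∈ disk, 0 < ν z) (hφ : DifferentiableOn ℂ φ disk)
    (hφm : MapsTo φ disk disk) (hψ : DifferentiableOn ℂ ψ disk) (hψm : MapsTo ψ disk disk)
    (hf : DifferentiableOn ℂ f disk) {z : ℂ} (hz : z ∈ disk) {η : ℝ}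
    (h1 : ‖deriv f (φ z)‖ ≤ η) (h2 : ‖deriv f (ψ z)‖ ≤ η) :
    ν z * ‖deriv (diffComp φ ψ f) z‖ ≤ η * (ν z * (‖deriv φ z‖ + ‖deriv ψ z‖)) := by
  rw [(hasDerivAt_diffComp hφ hφm hψ hψm hf hz).deriv]
  have h3 : ‖deriv f (φ z) * deriv φ z - deriv f (ψ z) * deriv ψ z‖
      ≤ η * ‖deriv φ z‖ + η * ‖deriv ψ z‖ := by
    refine (norm_sub_le _ _).trans ?_
    rw [norm_mul, norm_mul]
    gcongr
  calc _ ≤ ν z * (η * ‖deriv φ z‖ + η * ‖deriv ψ z‖) := mul_le_mul_of_nonneg_left h3 (hν z hz).le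
    _ = _ := by ring

theorem blochSeminorm_le {g : ℂ → ℂ} {C : ℝ} (h : ∀ z ∈ disk, ν z * ‖deriv g z‖ ≤ C)
    (hν : ∀ z ∈ disk, 0 < ν z) : blochSeminorm ν g ≤ ENNReal.ofReal C := by
  refine iSup₂_le fun z hz => ?_
  rw [← ofReal_norm, ← ENNReal.ofReal_mul (hν z hz).le]
  exact ENNReal.ofReal_le_ofReal (h z hz)

theorem BlochBound.norm_sub_le (h : BlochBound M f) (hf : DifferentiableOn ℂ f disk) {a b : ℂ}
    (ha : a ∈ disk) (hb : b ∈ disk) : ‖f b - f a‖ ≤ M / (1 - max ‖a‖ ‖b‖) * ‖b - a‖ := by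
  have hr : max ‖a‖ ‖b‖ < 1 := max_lt (mem_disk.1 ha) (mem_disk.1 hb)
  refine (convex_closedBall (0 : ℂ) (max ‖a‖ ‖b‖)).norm_image_sub_le_of_norm_deriv_le (𝕜 := ℂ)
    (fun u hu => hf.differentiableAt (isOpen_disk.mem_nhds (closedBall_subset_disk hr hu)))
    (fun u hu => (h.norm_deriv_le (closedBall_subset_disk hr hu)).trans ?_) ?_ ?_
  · have h0 := h.nonneg
    have : 0 < 1 - max ‖a‖ ‖b‖ := by linarith
    have : ‖u‖ ≤ max ‖a‖ ‖b‖ := by simpa using hu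
    gcongr
  · simp
  · simp

theorem tendsto_combination (hd : Tendsto (distortion ν φ ψ) toCircle (𝓝 0))
    (hh : Tendsto (hypDerivDiff ν φ ψ) toCircle (𝓝 0)) :
    Tendsto (fun z => 108 * distortion ν φ ψ z + hypDerivDiff ν φ ψ z) toCircle (𝓝 0) := by
  simpa using (hd.const_mul 108).add hh

/-- Near the boundary the pointwise estimate applies with its factor below 1. On the remaining
compact disc φ and ψ take values in a compact part of the disk, where f' is bounded by a multiple of
M. The value at 0 is controlled by integrating f' from ψ(0) to φ(0). -/
theorem exists_blochNorm_diffComp_le (hνc : ContinuousOn ν disk) (hν : ∀ z ∈ disk, 0 < ν z)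
    (hφ : DifferentiableOn ℂ φ disk) (hφm : MapsTo φ disk disk)
    (hψ : DifferentiableOn ℂ ψ disk) (hψm : MapsTo ψ disk disk)
    (hd : Tendsto (distortion ν φ ψ) toCircle (𝓝 0))
    (hh : Tendsto (hypDerivDiff ν φ ψ) toCircle (𝓝 0)) :
    ∃ C > 0, ∀ f M, DifferentiableOn ℂ f disk → BlochBound M f →
      blochNorm ν (diffComp φ ψ f) ≤ ENNReal.ofReal (C * M) := by
  obtain ⟨r, hr, hr1⟩ := exists_radius_of_tendsto (tendsto_combination hd hh) one_pos
  obtain ⟨Q, hQ0, hQ⟩ := exists_bound_weight_mul_deriv hνc hφ hψ hr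
  obtain ⟨s, hs, hs1⟩ := exists_radius_image hφ hφm hr
  obtain ⟨t, ht, ht1⟩ := exists_radius_image hψ hψm hr
  have hm : 0 < 1 - max s t := by
    have := max_lt hs ht
    linarith
  have h0 : 0 < 1 - max ‖ψ 0‖ ‖φ 0‖ := by
    have := max_lt (mem_disk.1 (hψm zero_mem_disk)) (mem_disk.1 (hφm zero_mem_disk))
    linarith
  refine ⟨‖φ 0 - ψ 0‖ / (1 - max ‖ψ 0‖ ‖φ 0‖) + (1 + Q / (1 - max s t)), by positivity,
    fun f M hf h => ?_⟩
  have hM := h.nonneg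
  rw [add_mul, ENNReal.ofReal_add (by positivity) (by positivity)]
  refine add_le_add ?_ (blochSeminorm_le (fun z hz => ?_) hν)
  · rw [diffComp_of_mem zero_mem_disk, ← ofReal_norm]
    refine ENNReal.ofReal_le_ofReal ((h.norm_sub_le hf (hψm zero_mem_disk)
      (hφm zero_mem_disk)).trans (le_of_eq ?_))
    ring
  · rcases lt_or_ge r ‖z‖ with hrz | hrz
    · refine (h.mul_norm_deriv_diffComp_le hν hφ hφm hψ hψm hf hz).trans ?_
      have h1 := hr1 z hz hrz
      have h2 : 0 ≤ Q / (1 - max s t) * M := by positivity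
      nlinarith
    · have hz' : z ∈ Metric.closedBall (0 : ℂ) r := by simpa using hrz
      have hb : ∀ u ∈ disk, ‖u‖ ≤ max s t → ‖deriv f u‖ ≤ M / (1 - max s t) := fun u hu hus =>
        (h.norm_deriv_le hu).trans (by gcongr)
      refine (norm_deriv_diffComp_le_of_le hν hφ hφm hψ hψm hf hz
        (hb _ (hφm hz) ((hs1 z hz').trans (le_max_left _ _)))
        (hb _ (hψm hz) ((ht1 z hz').trans (le_max_right _ _)))).trans ?_
      calc _ ≤ M / (1 - max s t) * Q := by gcongr; exact hQ z hz'
        _ ≤ M / (1 - max s t) * Q + M := by linarith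
        _ = _ := by ring

theorem diffComp_mem_littleBloch (hνc : ContinuousOn ν disk) (hν : ∀ z ∈ disk, 0 < ν z)
    (hφ : DifferentiableOn ℂ φ disk) (hφm : MapsTo φ disk disk)
    (hψ : DifferentiableOn ℂ ψ disk) (hψm : MapsTo ψ disk disk)
    (hd : Tendsto (distortion ν φ ψ) toCircle (𝓝 0))
    (hh : Tendsto (hypDerivDiff ν φ ψ) toCircle (𝓝 0))
    (hf : DifferentiableOn ℂ f disk) (h : BlochBound M f) :
    diffComp φ ψ f ∈ littleBlochSubmodule ν := by
  refine ⟨diffComp_mem_holoDisk hφ hφm hψ hψm hf, ?_, ?_⟩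
  · obtain ⟨C, _, hC⟩ := exists_blochNorm_diffComp_le hνc hν hφ hφm hψ hψm hd hh
    exact (le_add_self.trans (hC f M hf h)).trans_lt ENNReal.ofReal_lt_top
  · have h1 := (tendsto_combination hd hh).const_mul M
    rw [mul_zero] at h1
    refine squeeze_zero' ?_ ?_ h1
    · filter_upwards [eventually_disk] with z hz using
        mul_nonneg (hν z hz).le (norm_nonneg _)
    · filter_upwards [eventually_disk] with z hz using
        h.mul_norm_deriv_diffComp_le hν hφ hφm hψ hψm hf hz

end

/-! ### Normal families and sufficiency -/

section

/-- Normal families: a uniformly Bloch bounded sequence vanishing at the origin has a locally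
uniformly convergent subsequence. -/
theorem exists_subseq_tendstoLocallyUniformlyOn {M : ℝ} {f : ℕ → ℂ → ℂ}
    (hf : ∀ n, DifferentiableOn ℂ (f n) disk) (h : ∀ n, BlochBound M (f n))
    (h0 : ∀ n, f n 0 = 0) :
    ∃ k : ℕ → ℕ, StrictMono k ∧ ∃ g : ℂ → ℂ, DifferentiableOn ℂ g disk ∧ BlochBound M g ∧
      g 0 = 0 ∧ TendstoLocallyUniformlyOn (fun n => f (k n)) g atTop disk := by
  classical
  have : LocallyCompactSpace disk := isOpen_disk.locallyCompactSpace
  let L : disk → disk → ℝ := fun x y =>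
    M / (1 - max ‖(x : ℂ)‖ ‖(y : ℂ)‖) * ‖(y : ℂ) - (x : ℂ)‖
  have hL : ∀ x, Tendsto (L x) (𝓝 x) (𝓝 0) := fun x => by
    have hx : (1 - max ‖(x : ℂ)‖ ‖(x : ℂ)‖) ≠ 0 := by
      have := mem_disk.1 x.2
      rw [max_self]
      linarith
    have hc : ContinuousAt (L x) x := by
      refine ContinuousAt.mul (ContinuousAt.div continuousAt_const ?_ hx) ?_
      · fun_prop
      · fun_prop
    have : L x x = 0 := by simp [L]
    rw [← this]
    exact hc
  let o : disk := ⟨0, zero_mem_disk⟩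
  -- The modulus L gives equicontinuity at each point, and with the normalisation at 0 also
  -- pointwise bounds. Both conditions are closed under pointwise limits, so Arzelà–Ascoli makes S
  -- compact for locally uniform convergence.
  let S : Set C(disk, ℂ) := {u | u o = 0 ∧ ∀ x y, ‖u y - u x‖ ≤ L x y}
  have hmod : ∀ (u : disk → ℂ) (_ : ∀ x y, ‖u y - u x‖ ≤ L x y), Continuous u := fun u hu => by
    refine continuous_iff_continuousAt.2 fun x => ?_
    rw [ContinuousAt, tendsto_iff_norm_sub_tendsto_zero]
    exact squeeze_zero (fun _ => norm_nonneg _) (fun y => hu x y) (hL x)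
  have hS : IsCompact S := by
    refine ArzelaAscoli.isCompact_of_equicontinuous S ?_ ?_
    · have himg : ContinuousMap.toFun '' S
          = {u : disk → ℂ | u o = 0 ∧ ∀ x y, ‖u y - u x‖ ≤ L x y} := by
        ext u
        constructor
        · rintro ⟨v, hv, rfl⟩
          exact hv
        · intro hu
          exact ⟨⟨u, hmod u hu.2⟩, hu, rfl⟩
      rw [himg]
      refine (isCompact_univ_pi fun x => isCompact_closedBall (0 : ℂ) (L o x)).of_isClosed_subset
        ?_ ?_
      · refine IsClosed.inter (isClosed_eq (continuous_apply o) continuous_const) ?_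
        have hcl : IsClosed (⋂ x, ⋂ y, {u : disk → ℂ | ‖u y - u x‖ ≤ L x y}) :=
          isClosed_iInter fun x => isClosed_iInter fun y =>
            isClosed_le (by fun_prop) continuous_const
        have heq : {u : disk → ℂ | ∀ x y, ‖u y - u x‖ ≤ L x y}
            = ⋂ x, ⋂ y, {u : disk → ℂ | ‖u y - u x‖ ≤ L x y} := by
          ext u
          simp
        rw [← heq] at hcl
        exact hcl
      · intro u hu x _
        have := hu.2 o x
        rw [hu.1, sub_zero] at this
        simpa using this
    · intro x
      refine Metric.equicontinuousAt_of_continuity_modulus (L x) (hL x) _ (Eventually.of_forall ?_)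
      intro y u
      rw [dist_comm, dist_eq_norm]
      exact u.2.2 x y
  let F : ℕ → C(disk, ℂ) := fun n => ⟨fun x => f n x, (hf n).continuousOn.domRestrict⟩
  have hF : ∀ n, F n ∈ S := fun n => ⟨h0 n, fun x y => (h n).norm_sub_le (hf n) x.2 y.2⟩
  obtain ⟨u, hu, k, hk, hlim⟩ := hS.isSeqCompact hF
  let g : ℂ → ℂ := fun z => if hz : z ∈ disk then u ⟨z, hz⟩ else 0
  have hg : g ∘ ((↑) : disk → ℂ) = u := funext fun x => by simp [g]
  have hloc : TendstoLocallyUniformlyOn (fun n => f (k n)) g atTop disk := by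
    rw [tendstoLocallyUniformlyOn_iff_tendstoLocallyUniformly_comp_coe, hg]
    exact ContinuousMap.tendsto_iff_tendstoLocallyUniformly.1 hlim
  have hfk : ∀ᶠ n in atTop, DifferentiableOn ℂ (f (k n)) disk := Eventually.of_forall fun n => hf _
  refine ⟨k, hk, g, hloc.differentiableOn hfk isOpen_disk, fun z hz => ?_, ?_, hloc⟩
  · exact le_of_tendsto (((hloc.deriv hfk isOpen_disk).tendsto_at hz).norm.const_mul _)
      (Eventually.of_forall fun n => h (k n) z hz)
  · exact tendsto_nhds_unique (hloc.tendsto_at zero_mem_disk)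
      (by simpa only [h0] using tendsto_const_nhds)

variable {ν : ℂ → ℝ} {φ ψ : ℂ → ℂ} {M : ℝ}

/-- The common Bloch bound makes the boundary region small uniformly in n. Inside, locally uniform
convergence passes to the derivatives and handles a compact disc containing the values of φ and ψ.
-/
theorem tendsto_blochNorm_diffComp (hνc : ContinuousOn ν disk) (hν : ∀ z ∈ disk, 0 < ν z)
    (hφ : DifferentiableOn ℂ φ disk) (hφm : MapsTo φ disk disk)
    (hψ : DifferentiableOn ℂ ψ disk) (hψm : MapsTo ψ disk disk)
    (hd : Tendsto (distortion ν φ ψ) toCircle (𝓝 0))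
    (hh : Tendsto (hypDerivDiff ν φ ψ) toCircle (𝓝 0)) {g : ℕ → ℂ → ℂ}
    (hg : ∀ n, DifferentiableOn ℂ (g n) disk) (hM : ∀ n, BlochBound M (g n))
    (hlim : TendstoLocallyUniformlyOn g 0 atTop disk) :
    Tendsto (fun n => blochNorm ν (diffComp φ ψ (g n))) atTop (𝓝 0) := by
  have hat : ∀ z ∈ disk, Tendsto (fun n => g n z) atTop (𝓝 0) := fun z hz => by
    simpa using hlim.tendsto_at hz
  have h0 : Tendsto (fun n => ‖diffComp φ ψ (g n) 0‖ₑ) atTop (𝓝 0) := by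
    simp only [diffComp_of_mem zero_mem_disk]
    have := ((hat _ (hφm zero_mem_disk)).sub (hat _ (hψm zero_mem_disk))).enorm
    simpa using this
  have h1 : Tendsto (fun n => blochSeminorm ν (diffComp φ ψ (g n))) atTop (𝓝 0) := by
    refine ENNReal.tendsto_nhds_zero.2 fun δ hδ => ?_
    obtain ⟨ε, hε, hεδ⟩ : ∃ ε : ℝ, 0 < ε ∧ ENNReal.ofReal ε ≤ δ := by
      obtain ⟨e, he, hed⟩ := ENNReal.lt_iff_exists_nnreal_btwn.1 hδ
      exact ⟨e, by exact_mod_cast he, by simpa using hed.le⟩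
    have hcomb := (tendsto_combination hd hh).const_mul M
    rw [mul_zero] at hcomb
    obtain ⟨r, hr, hr1⟩ := exists_radius_of_tendsto hcomb hε
    obtain ⟨Q, hQ0, hQ⟩ := exists_bound_weight_mul_deriv hνc hφ hψ hr
    obtain ⟨s, hs, hs1⟩ := exists_radius_image hφ hφm hr
    obtain ⟨t, ht, ht1⟩ := exists_radius_image hψ hψm hr
    have hder := hlim.deriv (Eventually.of_forall hg) isOpen_disk
    have hunif := (tendstoLocallyUniformlyOn_iff_forall_isCompact isOpen_disk).1 hder
      (Metric.closedBall 0 (max s t)) (closedBall_subset_disk (max_lt hs ht))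
      (isCompact_closedBall _ _)
    have hev := Metric.tendstoUniformlyOn_iff.1 hunif (ε / Q) (by positivity)
    filter_upwards [hev] with n hn
    refine (blochSeminorm_le (fun z hz => ?_) hν).trans hεδ
    rcases lt_or_ge r ‖z‖ with hrz | hrz
    · exact ((hM n).mul_norm_deriv_diffComp_le hν hφ hφm hψ hψm (hg n) hz).trans
        (hr1 z hz hrz).le
    · have hz' : z ∈ Metric.closedBall (0 : ℂ) r := by simpa using hrz
      have hb : ∀ u, ‖u‖ ≤ max s t → ‖deriv (g n) u‖ ≤ ε / Q := fun u hu => by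
        have := hn u (by simpa using hu)
        have h2 : deriv (0 : ℂ → ℂ) u = 0 := by simp
        rw [h2, dist_zero_left] at this
        exact this.le
      refine (norm_deriv_diffComp_le_of_le hν hφ hφm hψ hψm (hg n) hz
        (hb _ ((hs1 z hz').trans (le_max_left _ _)))
        (hb _ ((ht1 z hz').trans (le_max_right _ _)))).trans ?_
      calc _ ≤ ε / Q * Q := by gcongr; exact hQ z hz'
        _ = ε := div_mul_cancel₀ _ hQ0.ne'
  simpa [blochNorm] using h0.add h1

/-- Both the Bloch bound and the value at 0 survive locally uniform limits, so this set is itself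
compact and no closure is needed. -/
theorem isCompact_image_blochBound (hνc : ContinuousOn ν disk) (hν : ∀ z ∈ disk, 0 < ν z)
    (hφ : DifferentiableOn ℂ φ disk) (hφm : MapsTo φ disk disk)
    (hψ : DifferentiableOn ℂ ψ disk) (hψm : MapsTo ψ disk disk)
    (hd : Tendsto (distortion ν φ ψ) toCircle (𝓝 0))
    (hh : Tendsto (hypDerivDiff ν φ ψ) toCircle (𝓝 0)) (M : ℝ) :
    IsCompact {F : LittleBloch ν | ∃ f, DifferentiableOn ℂ f disk ∧ BlochBound M f ∧ f 0 = 0 ∧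
      F.1 = diffComp φ ψ f} := by
  refine IsSeqCompact.isCompact fun F hF => ?_
  choose f hf hM h0 hFf using hF
  obtain ⟨k, hk, g, hg, hgM, hg0, hlim⟩ := exists_subseq_tendstoLocallyUniformlyOn hf hM h0
  let G : LittleBloch ν :=
    ⟨diffComp φ ψ g, diffComp_mem_littleBloch hνc hν hφ hφm hψ hψm hd hh hg hgM⟩
  refine ⟨G, ⟨g, hg, hgM, hg0, rfl⟩, k, hk, ?_⟩
  rw [tendsto_iff_edist_tendsto_0]
  have hsub : ∀ n, DifferentiableOn ℂ (f (k n) - g) disk := fun n => (hf _).sub hg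
  -- The difference of two functions with Bloch bound M has Bloch bound 2M.
  have h1 := tendsto_blochNorm_diffComp (M := 2 * M) hνc hν hφ hφm hψ hψm hd hh
    (g := fun n => f (k n) - g) hsub (fun n z hz => ?_) ?_
  · refine h1.congr fun n => ?_
    rw [diffComp_sub, ← hFf]
    rfl
  · have h2 : deriv (f (k n) - g) z = deriv (f (k n)) z - deriv g z :=
      deriv_sub ((hf _).differentiableAt (isOpen_disk.mem_nhds hz))
        (hg.differentiableAt (isOpen_disk.mem_nhds hz))
    rw [h2]
    have h3 := hM (k n) z hz
    have h4 := hgM z hz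
    have h5 := norm_sub_le (deriv (f (k n)) z) (deriv g z)
    have h6 := mul_le_mul_of_nonneg_left h5 (one_sub_norm_sq_pos hz).le
    linarith
  · rw [Metric.tendstoLocallyUniformlyOn_iff] at hlim ⊢
    intro ε hε x hx
    obtain ⟨t, ht, hev⟩ := hlim ε hε x hx
    refine ⟨t, ht, hev.mono fun n hn y hy => ?_⟩
    have := hn y hy
    rw [dist_comm, dist_eq_norm] at this
    change dist 0 (f (k n) y - g y) < ε
    rwa [dist_zero_left]

theorem exists_compact_operator (p : ℝ) [hp : Fact (1 ≤ p)] (hνc : ContinuousOn ν disk)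
    (hν : ∀ z ∈ disk, 0 < ν z)
    (hφ : DifferentiableOn ℂ φ disk) (hφm : MapsTo φ disk disk)
    (hψ : DifferentiableOn ℂ ψ disk) (hψm : MapsTo ψ disk disk)
    (hd : Tendsto (distortion ν φ ψ) toCircle (𝓝 0))
    (hh : Tendsto (hypDerivDiff ν φ ψ) toCircle (𝓝 0)) :
    ∃ T : Besov p →L[ℂ] LittleBloch ν,
      (∀ f : Besov p, ∀ z ∈ disk, (T f) z = f (φ z) - f (ψ z)) ∧ IsCompactOperator T := by
  let T : Besov p →ₗ[ℂ] LittleBloch ν :=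
    { toFun := fun f => ⟨diffComp φ ψ f.1, by
        obtain ⟨M, hM⟩ := exists_blochBound_of_mem f.2
        exact diffComp_mem_littleBloch hνc hν hφ hφm hψ hψm hd hh f.2.1.1 hM⟩
      map_add' := fun f g => Subtype.ext (diffComp_add φ ψ f.1 g.1)
      map_smul' := fun c f => Subtype.ext (diffComp_smul φ ψ f.1 c) }
  obtain ⟨C, hC0, hC⟩ := exists_blochBound_of_besovNorm p hp.out
  obtain ⟨D, hD0, hD⟩ := exists_blochNorm_diffComp_le hνc hν hφ hφm hψ hψm hd hh
  have hT : Continuous T := by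
    refine EMetric.continuous_iff.2 fun f ε hε => ?_
    -- Here ε may be infinite; a finite positive e below it makes the real constant e/(DC)
    -- available.
    obtain ⟨e, he, hee⟩ := ENNReal.lt_iff_exists_nnreal_btwn.1 hε
    have he0 : (0 : ℝ) < e := by exact_mod_cast he
    refine ⟨ENNReal.ofReal (e / (D * C)), by simpa using (by positivity), fun g hg => ?_⟩
    have h1 := hC (g.1 - f.1) (g.2.1.1.sub f.2.1.1) (e / (D * C)) (by positivity) hg
    have h2 := hD _ _ (g.2.1.1.sub f.2.1.1) h1
    have h3 : edist (T g) (T f) = blochNorm ν (diffComp φ ψ (g.1 - f.1)) := by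
      rw [diffComp_sub]
      rfl
    rw [h3]
    refine h2.trans_lt (lt_of_eq_of_lt ?_ hee)
    have h4 : D * (C * (e / (D * C))) = e := by field_simp
    rw [h4, ENNReal.ofReal_coe_nnreal]
  refine ⟨⟨T, hT⟩, fun f z hz => diffComp_of_mem hz, ?_⟩
  refine ⟨_, isCompact_image_blochBound hνc hν hφ hφm hψ hψm hd hh (C * 1), ?_⟩
  refine EMetric.mem_nhds_iff.2 ⟨1, one_pos, fun f hf => ?_⟩
  have h1 : besovNorm p f.1 < ENNReal.ofReal 1 := by
    have h2 : edist f 0 < 1 := hf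
    have h3 : edist f 0 = besovNorm p (f.1 - 0) := rfl
    rw [h3, sub_zero] at h2
    simpa using h2
  have h2 := hC f.1 f.2.1.1 1 one_pos h1
  -- The operator annihilates constants, so subtracting f(0) gives the normalisation at no cost.
  refine ⟨fun z => f.1 z - f.1 0, f.2.1.1.sub_const _, fun z hz => ?_, sub_self _, ?_⟩
  · rw [deriv_sub_const]
    exact h2 z hz
  · change diffComp φ ψ f.1 = _
    funext z
    by_cases hz : z ∈ disk
    · rw [diffComp_of_mem hz, diffComp_of_mem hz]
      ring
    · simp [diffComp, hz]

end

/-! ### Möbius kernels and the three-point test -/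

/-- The function `(1 - |w|²) (1 - |u|²) / (1 - conj w * u)²`, which up to sign is
`(1 - |u|²) α_w'(u)`. -/
noncomputable def mobiusKernel (w u : ℂ) : ℂ :=
  (1 - ‖w‖ ^ 2 : ℝ) * (1 - ‖u‖ ^ 2 : ℝ) / (1 - (starRingEnd ℂ) w * u) ^ 2

theorem ofReal_one_sub_norm_sq (w : ℂ) :
    ((1 - ‖w‖ ^ 2 : ℝ) : ℂ) = 1 - (starRingEnd ℂ) w * w := by
  rw [Complex.conj_mul']
  push_cast
  rfl

theorem mobiusKernel_self {a : ℂ} (ha : a ∈ disk) : mobiusKernel a a = 1 := by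
  have h := one_sub_conj_mul_ne_zero ha ha
  rw [mobiusKernel, ofReal_one_sub_norm_sq]
  field_simp

theorem one_sub_norm_mobius_sq {w z : ℂ} (hw : w ∈ disk) (hz : z ∈ disk) :
    1 - ‖mobius w z‖ ^ 2
      = (1 - ‖w‖ ^ 2) * (1 - ‖z‖ ^ 2) / ‖1 - (starRingEnd ℂ) w * z‖ ^ 2 := by
  have h : ‖1 - (starRingEnd ℂ) w * z‖ ≠ 0 := norm_ne_zero_iff.2 (one_sub_conj_mul_ne_zero hw hz)
  rw [← norm_one_sub_conj_mul_sq_sub, mobius, norm_div, div_pow, sub_div, div_self (pow_ne_zero 2 h)]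

theorem mobius_mem_disk {w z : ℂ} (hw : w ∈ disk) (hz : z ∈ disk) : mobius w z ∈ disk := by
  have h0 := norm_pos_iff.2 (one_sub_conj_mul_ne_zero hw hz)
  have h1 := one_sub_norm_mobius_sq hw hz
  have h2 := one_sub_norm_sq_pos hw
  have h3 := one_sub_norm_sq_pos hz
  have h4 : 0 < 1 - ‖mobius w z‖ ^ 2 := by
    rw [h1]
    positivity
  rw [mem_disk]
  nlinarith [norm_nonneg (mobius w z)]

theorem norm_mobius_eq (a b : ℂ) : ‖mobius a b‖ = pseudoHyp a b := by
  rw [pseudoHyp_eq, mobius, norm_div]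

theorem norm_mobiusKernel {a b : ℂ} (ha : a ∈ disk) (hb : b ∈ disk) :
    ‖mobiusKernel a b‖ = 1 - pseudoHyp a b ^ 2 := by
  rw [← norm_mobius_eq, one_sub_norm_mobius_sq ha hb, mobiusKernel, norm_div, norm_mul, norm_pow,
    Complex.norm_real, Complex.norm_real, Real.norm_of_nonneg (one_sub_norm_sq_pos ha).le,
    Real.norm_of_nonneg (one_sub_norm_sq_pos hb).le]

theorem norm_mobiusKernel_sub_one_le {a b : ℂ} (ha : a ∈ disk) (hb : b ∈ disk) :
    ‖mobiusKernel a b - 1‖ ≤ 3 * pseudoHyp a b := by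
  have hD := one_sub_conj_mul_ne_zero ha hb
  have hρ1 : pseudoHyp a b ≤ 1 := by
    rw [← norm_mobius_eq]
    exact norm_mobius_le_one ha hb
  set D := 1 - (starRingEnd ℂ) a * b with hDdef
  set x := (starRingEnd ℂ) a * ((a - b) / D) with hx
  set y := b * (((starRingEnd ℂ) (a - b)) / D) with hy
  have hxρ : ‖x‖ ≤ pseudoHyp a b := by
    rw [hx, norm_mul, RCLike.norm_conj, norm_div, ← pseudoHyp_eq]
    exact mul_le_of_le_one_left (norm_nonneg _) (mem_disk.1 ha).le
  have hyρ : ‖y‖ ≤ pseudoHyp a b := by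
    rw [hy, norm_mul, norm_div, RCLike.norm_conj, ← pseudoHyp_eq]
    exact mul_le_of_le_one_left (norm_nonneg _) (mem_disk.1 hb).le
  -- The kernel factors as (1 - x)(1 + y), with 1 - x = (1 - |a|²)/D and 1 + y = (1 - |b|²)/D.
  have e : mobiusKernel a b - 1 = y - x - x * y := by
    rw [mobiusKernel, ofReal_one_sub_norm_sq, ofReal_one_sub_norm_sq, ← hDdef, hx, hy]
    field_simp
    rw [hDdef, map_sub]
    ring
  rw [e]
  have h1 := norm_sub_le (y - x) (x * y)
  have h2 := norm_sub_le y x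
  rw [norm_mul] at h1
  have h3 : ‖x‖ * ‖y‖ ≤ pseudoHyp a b * 1 :=
    mul_le_mul hxρ (hyρ.trans hρ1) (norm_nonneg _) (norm_nonneg _)
  linarith

/-- The chain rule for α_s ∘ α_a, which is a unimodular multiple of the automorphism with zero
α_a(s). It moves a to the origin, where a test point s can be chosen relative to α_a(b). -/
theorem mobiusKernel_mobius {a s u : ℂ} (ha : a ∈ disk) (hs : s ∈ disk) (hu : u ∈ disk) :
    mobiusKernel (mobius a s) u
      = (1 - a * (starRingEnd ℂ) s) / (1 - (starRingEnd ℂ) a * s) * (1 - ‖s‖ ^ 2 : ℝ)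
        * (mobiusKernel a u / (1 - (starRingEnd ℂ) s * mobius a u) ^ 2) := by
  have h1 := one_sub_conj_mul_ne_zero ha hs
  have h2 := one_sub_conj_mul_ne_zero ha hu
  have h3 := one_sub_conj_mul_ne_zero hs (mobius_mem_disk ha hu)
  have h4 := one_sub_conj_mul_ne_zero (mobius_mem_disk ha hs) hu
  have h5 : 1 - a * (starRingEnd ℂ) s ≠ 0 := by
    have := one_sub_conj_mul_ne_zero hs ha
    rwa [mul_comm] at this
  have e0 : (starRingEnd ℂ) (mobius a s)
      = ((starRingEnd ℂ) a - (starRingEnd ℂ) s) / (1 - a * (starRingEnd ℂ) s) := by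
    simp [mobius]
  have e1 : 1 - (starRingEnd ℂ) (mobius a s) * u
      = (1 - (starRingEnd ℂ) a * u) * (1 - (starRingEnd ℂ) s * mobius a u)
        / (1 - a * (starRingEnd ℂ) s) := by
    rw [e0, mobius]
    -- The conjugates of a and s are treated as independent variables, which turns the claim into an
    -- identity of rational functions.
    have key : ∀ x y : ℂ, 1 - x * u ≠ 0 → 1 - a * y ≠ 0 → 1 - (x - y) / (1 - a * y) * u
        = (1 - x * u) * (1 - y * ((a - u) / (1 - x * u))) / (1 - a * y) := by
      intro x y hx hy
      have hy' : 1 - y * a ≠ 0 := by rwa [mul_comm]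
      field_simp
      ring
    exact key _ _ h2 h5
  have e2 : 1 - (starRingEnd ℂ) (mobius a s) * mobius a s
      = (1 - (starRingEnd ℂ) a * a) * (1 - (starRingEnd ℂ) s * s)
        / ((1 - a * (starRingEnd ℂ) s) * (1 - (starRingEnd ℂ) a * s)) := by
    rw [e0, mobius]
    have key : ∀ x y : ℂ, 1 - x * s ≠ 0 → 1 - a * y ≠ 0 →
        1 - (x - y) / (1 - a * y) * ((a - s) / (1 - x * s))
          = (1 - x * a) * (1 - y * s) / ((1 - a * y) * (1 - x * s)) := by
      intro x y hx hy
      have hy' : 1 - y * a ≠ 0 := by rwa [mul_comm]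
      field_simp
      ring
    exact key _ _ h1 h5
  simp only [mobiusKernel, ofReal_one_sub_norm_sq]
  rw [e1, e2]
  field_simp

/-- If `A τ_w(a) - B τ_w(b)` is uniformly small in `w`, then so are `A ρ(a, b)`, `B ρ(a, b)` and
`A - B`. -/
theorem mobiusKernel_test {a b A B : ℂ} {ε : ℝ} (ha : a ∈ disk) (hb : b ∈ disk)
    (h : ∀ w ∈ disk, ‖A * mobiusKernel w a - B * mobiusKernel w b‖ ≤ ε) :
    ‖A‖ * pseudoHyp a b ≤ 6 * ε ∧ ‖B‖ * pseudoHyp a b ≤ 5 * ε ∧ ‖A - B‖ ≤ 16 * ε := by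
  have hρ0 : 0 ≤ pseudoHyp a b := norm_nonneg _
  have hρ1 : pseudoHyp a b ≤ 1 := by
    rw [← norm_mobius_eq]
    exact norm_mobius_le_one ha hb
  have hε : 0 ≤ ε := (norm_nonneg _).trans (h a ha)
  have hK := norm_mobiusKernel ha hb
  have hK1 := norm_mobiusKernel_sub_one_le ha hb
  have ha1 := h a ha
  have hb1 := h b hb
  rw [mobiusKernel_self ha, mul_one] at ha1
  rw [mobiusKernel_self hb, mul_one] at hb1
  have hK' := norm_mobiusKernel hb ha
  rw [pseudoHyp_comm b a] at hK'
  set ρ := pseudoHyp a b with hρ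
  -- The tests w = a and w = b. Alone they control only |B|ρ², one order in ρ too weak when ρ is
  -- small.
  have i1 : ‖A‖ ≤ ‖B‖ * (1 - ρ ^ 2) + ε := by
    have := norm_sub_norm_le A (B * mobiusKernel a b)
    rw [norm_mul, hK] at this
    linarith
  have i2 : ‖B‖ ≤ ‖A‖ * (1 - ρ ^ 2) + ε := by
    have := norm_sub_norm_le B (A * mobiusKernel b a)
    rw [norm_mul, hK', norm_sub_rev] at this
    linarith
  -- The third test is w = α_a(s) with |s| = 1/2 and s in the direction of β = α_a(b). It multiplies
  -- the kernel at b, relative to that at a, by 1/(1 - ρ/2)², which exceeds 1 by at least ρ.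
  -- Subtracting the test w = a isolates this first-order term, with error ε + (4/3)ε; the factor
  -- 4/3 undoes 1 - |s|² = 3/4.
  have i3 : ‖B‖ * (1 - ρ ^ 2) * ρ ≤ 7 / 3 * ε := by
    rcases hρ0.eq_or_lt with h0 | h0
    · rw [← h0, mul_zero]
      positivity
    set β := mobius a b with hβ
    have hβρ : ‖β‖ = ρ := norm_mobius_eq a b
    have hρc : (ρ : ℂ) ≠ 0 := by exact_mod_cast h0.ne'
    set s : ℂ := β / (2 * ρ) with hs
    have hsn : ‖s‖ = 1 / 2 := by
      rw [hs, norm_div, hβρ, norm_mul, Complex.norm_real, Real.norm_of_nonneg hρ0]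
      simp
      field_simp
    have hsd : s ∈ disk := by
      rw [mem_disk, hsn]
      norm_num
    have hsβ : (starRingEnd ℂ) s * β = (ρ / 2 : ℝ) := by
      rw [hs, map_div₀, div_mul_eq_mul_div, Complex.conj_mul', hβρ]
      simp
      field_simp
      exact (map_ofNat _ 2).symm
    have h1 := h _ (mobius_mem_disk ha hsd)
    have haa : mobius a a = 0 := by simp [mobius]
    rw [mobiusKernel_mobius ha hsd ha, mobiusKernel_mobius ha hsd hb, ← hβ, hsβ, haa,
      mobiusKernel_self ha, hsn] at h1
    set κ := (1 - a * (starRingEnd ℂ) s) / (1 - (starRingEnd ℂ) a * s) with hκ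
    have hκ1 : ‖κ‖ = 1 := by
      rw [hκ, norm_div, ← RCLike.norm_conj (1 - a * _)]
      simp only [map_sub, map_one, map_mul, Complex.conj_conj]
      exact div_self (norm_ne_zero_iff.2 (one_sub_conj_mul_ne_zero ha hsd))
    have e : A * (κ * ((1 - (1 / 2 : ℝ) ^ 2 : ℝ) : ℂ) * (1 / (1 - (starRingEnd ℂ) s * 0) ^ 2))
        - B * (κ * ((1 - (1 / 2 : ℝ) ^ 2 : ℝ) : ℂ)
          * (mobiusKernel a b / (1 - ((ρ / 2 : ℝ) : ℂ)) ^ 2))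
        = κ * ((3 / 4 : ℝ) : ℂ) * (A - B * mobiusKernel a b * (((1 - ρ / 2) ^ 2)⁻¹ : ℝ)) := by
      push_cast
      ring
    rw [e, norm_mul, norm_mul, hκ1, Complex.norm_real, one_mul, Real.norm_of_nonneg (by norm_num)]
      at h1
    have e2 : B * mobiusKernel a b * (((1 - ρ / 2) ^ 2)⁻¹ - 1 : ℝ)
        = (A - B * mobiusKernel a b)
          - (A - B * mobiusKernel a b * (((1 - ρ / 2) ^ 2)⁻¹ : ℝ)) := by
      push_cast
      ring
    have h2 := norm_sub_le (A - B * mobiusKernel a b)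
      (A - B * mobiusKernel a b * (((1 - ρ / 2) ^ 2)⁻¹ : ℝ))
    rw [← e2, norm_mul, norm_mul, hK, Complex.norm_real] at h2
    have h3 : ρ ≤ ((1 - ρ / 2) ^ 2)⁻¹ - 1 := by
      rw [le_sub_iff_add_le, le_inv_comm₀ (by positivity) (by nlinarith)]
      rw [← one_div, le_div_iff₀ (by positivity)]
      nlinarith [mul_nonneg hρ0 hρ0, mul_nonneg (mul_nonneg hρ0 hρ0) (sub_nonneg.2 hρ1)]
    have h4 : ‖B‖ * (1 - ρ ^ 2) * ρ ≤ ‖B‖ * (1 - ρ ^ 2) * ‖((1 - ρ / 2) ^ 2)⁻¹ - 1‖ :=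
      mul_le_mul_of_nonneg_left (h3.trans (le_abs_self _))
        (mul_nonneg (norm_nonneg _) (by nlinarith))
    linarith
  have hσ : 0 ≤ 1 - ρ ^ 2 := by nlinarith
  -- Inserting `i1` into `i2` gives |B|(1 - (1 - ρ²)²) ≤ 2ε, and the bracket is at least ρ².
  have i4 : ‖B‖ * ρ ^ 2 ≤ 2 * ε := by
    have h1 : ‖A‖ * (1 - ρ ^ 2) ≤ (‖B‖ * (1 - ρ ^ 2) + ε) * (1 - ρ ^ 2) :=
      mul_le_mul_of_nonneg_right i1 hσ
    have h2 : 0 ≤ ‖B‖ * ρ ^ 2 * (1 - ρ ^ 2) := by positivity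
    nlinarith [mul_nonneg hε (sq_nonneg ρ)]
  -- Split |B|ρ as |B|(1 - ρ²)ρ + |B|ρ³; the bounds 7/3 and 2 add up to less than 5.
  have i5 : ‖B‖ * ρ ≤ 5 * ε := by
    have h1 : ‖B‖ * ρ ^ 2 * ρ ≤ 2 * ε * 1 := mul_le_mul i4 hρ1 hρ0 (by positivity)
    nlinarith
  refine ⟨?_, i5, ?_⟩
  · have h1 : ‖A‖ * ρ ≤ (‖B‖ * (1 - ρ ^ 2) + ε) * ρ := mul_le_mul_of_nonneg_right i1 hρ0
    nlinarith [mul_nonneg (mul_nonneg (norm_nonneg B) (sq_nonneg ρ)) hρ0]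
  · have e : A - B = (A - B * mobiusKernel a b) + B * (mobiusKernel a b - 1) := by ring
    rw [e]
    refine (norm_add_le _ _).trans ?_
    rw [norm_mul]
    nlinarith [mul_le_mul_of_nonneg_left hK1 (norm_nonneg B)]

/-! ### Automorphisms as uniformly bounded elements of the Besov spaces -/

/-- The automorphism `α_w` on the disk, extended by zero. -/
noncomputable def mobiusFun (w : ℂ) : ℂ → ℂ := disk.indicator (mobius w)

theorem mobiusFun_of_mem {w z : ℂ} (hz : z ∈ disk) : mobiusFun w z = mobius w z :=
  indicator_of_mem hz _

theorem hasDerivAt_mobius {w z : ℂ} (hw : w ∈ disk) (hz : z ∈ disk) :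
    HasDerivAt (mobius w) (-(1 - ‖w‖ ^ 2 : ℝ) / (1 - (starRingEnd ℂ) w * z) ^ 2) z := by
  have h := one_sub_conj_mul_ne_zero hw hz
  have h1 : HasDerivAt (fun z => w - z) (-1) z := (hasDerivAt_id z).const_sub w
  have h2 : HasDerivAt (fun z => 1 - (starRingEnd ℂ) w * z) (-((starRingEnd ℂ) w * 1)) z :=
    ((hasDerivAt_id z).const_mul _).const_sub 1
  refine (h1.div h2 h).congr_deriv ?_
  rw [ofReal_one_sub_norm_sq]
  congr 1
  ring

theorem hasDerivAt_mobiusFun {w z : ℂ} (hw : w ∈ disk) (hz : z ∈ disk) :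
    HasDerivAt (mobiusFun w) (-(1 - ‖w‖ ^ 2 : ℝ) / (1 - (starRingEnd ℂ) w * z) ^ 2) z := by
  refine (hasDerivAt_mobius hw hz).congr_of_eventuallyEq ?_
  filter_upwards [isOpen_disk.mem_nhds hz] with u hu using mobiusFun_of_mem hu

theorem mobiusFun_mem_holoDisk {w : ℂ} (hw : w ∈ disk) : mobiusFun w ∈ holoDisk :=
  ⟨fun _ hz => (hasDerivAt_mobiusFun hw hz).differentiableAt.differentiableWithinAt,
    fun _ hz => indicator_of_notMem hz _⟩

theorem diskArea_univ_lt_top : diskArea univ < ∞ := by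
  rw [diskArea, Measure.smul_apply, Measure.restrict_apply_univ, smul_eq_mul]
  exact ENNReal.mul_lt_top (by simp [Real.pi_pos]) measure_ball_lt_top

/-- The second derivative is bounded on the disk. The bound degenerates as |w| → 1, but it serves
only for membership; for p = 1 uniformity in w comes from the atomic norm. -/
theorem secondIntegral_mobiusFun_lt_top {w : ℂ} (hw : w ∈ disk) :
    secondIntegral (mobiusFun w) < ∞ := by
  have hw' : 0 < 1 - ‖w‖ := by linarith [mem_disk.1 hw]
  have hbd : ∀ z ∈ disk, ‖deriv (deriv (mobiusFun w)) z‖ₑ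
      ≤ ENNReal.ofReal (2 / (1 - ‖w‖) ^ 3) := fun z hz => by
    set D := 1 - (starRingEnd ℂ) w * z with hDdef
    have hD0 : D ≠ 0 := one_sub_conj_mul_ne_zero hw hz
    have hD : 1 - ‖w‖ ≤ ‖D‖ := by
      have h1 := norm_sub_norm_le 1 ((starRingEnd ℂ) w * z)
      rw [norm_one, norm_mul, RCLike.norm_conj] at h1
      have h2 : ‖w‖ * ‖z‖ ≤ ‖w‖ := mul_le_of_le_one_right (norm_nonneg _) (mem_disk.1 hz).le
      linarith
    have h1 : HasDerivAt (fun z => 1 - (starRingEnd ℂ) w * z) (-((starRingEnd ℂ) w * 1)) z :=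
      ((hasDerivAt_id z).const_mul _).const_sub 1
    have h2 := (hasDerivAt_const z (-((1 - ‖w‖ ^ 2 : ℝ) : ℂ))).div (h1.pow 2) (pow_ne_zero 2 hD0)
    have h3 : deriv (mobiusFun w) =ᶠ[𝓝 z]
        fun z => -(1 - ‖w‖ ^ 2 : ℝ) / (1 - (starRingEnd ℂ) w * z) ^ 2 := by
      filter_upwards [isOpen_disk.mem_nhds hz] with u hu using (hasDerivAt_mobiusFun hw hu).deriv
    have h4 : deriv (deriv (mobiusFun w)) z
        = -(2 * ((1 - ‖w‖ ^ 2 : ℝ) : ℂ) * (starRingEnd ℂ) w / D ^ 3) := by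
      refine h3.deriv_eq.trans (h2.deriv.trans ?_)
      simp only [Pi.pow_apply, ← hDdef]
      field_simp
      push_cast
      ring
    have hw1 := one_sub_norm_sq_pos hw
    rw [h4, ← ofReal_norm, norm_neg, norm_div, norm_mul, norm_mul, Complex.norm_real,
      RCLike.norm_conj, norm_pow, Real.norm_of_nonneg hw1.le]
    refine ENNReal.ofReal_le_ofReal ?_
    have h5 : ‖(2 : ℂ)‖ * (1 - ‖w‖ ^ 2) * ‖w‖ ≤ 2 := by
      have h6 : (1 - ‖w‖ ^ 2) * ‖w‖ ≤ 1 :=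
        mul_le_one₀ (by nlinarith [norm_nonneg w]) (norm_nonneg _) (mem_disk.1 hw).le
      simp only [Complex.norm_ofNat]
      linarith
    gcongr
  calc secondIntegral (mobiusFun w)
      ≤ ∫⁻ _, ENNReal.ofReal (2 / (1 - ‖w‖) ^ 3) ∂diskArea :=
        lintegral_mono_ae (ae_disk.mono hbd)
    _ < ∞ := by
      rw [lintegral_const]
      exact ENNReal.mul_lt_top ENNReal.ofReal_lt_top diskArea_univ_lt_top

/-- The real Jacobian of a holomorphic map is |f'|². -/
theorem det_smul_one (c : ℂ) : (c • (1 : ℂ →L[ℝ] ℂ)).det = Complex.normSq c := by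
  rw [← Algebra.norm_complex_apply, Algebra.norm_apply, ContinuousLinearMap.det]
  congr 1

theorem injOn_mobius {w : ℂ} (hw : w ∈ disk) : InjOn (mobius w) disk := by
  intro z hz u hu h
  have h1 := one_sub_conj_mul_ne_zero hw hz
  have h2 := one_sub_conj_mul_ne_zero hw hu
  have h3 := one_sub_conj_mul_ne_zero hw hw
  rw [mobius, mobius, div_eq_div_iff h1 h2] at h
  have h4 : (1 - (starRingEnd ℂ) w * w) * (z - u) = 0 := by linear_combination -h
  exact sub_eq_zero.1 ((mul_eq_zero.1 h4).resolve_left h3)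

theorem lintegral_one_sub_norm_sq_rpow_lt_top {q : ℝ} (hq : -1 < q) :
    ∫⁻ u in disk, ENNReal.ofReal ((1 - ‖u‖ ^ 2) ^ q) < ∞ := by
  have hm : Measurable fun u : ℂ => ENNReal.ofReal ((1 - ‖u‖ ^ 2) ^ q) := by fun_prop
  -- The exponent min q 0 lets (1 - ρ)^(min q 0) dominate (1 - ρ²)^q for either sign of q, and it
  -- still exceeds -1.
  have hq' : -1 < min q 0 := lt_min hq (by norm_num)
  have hint : IntegrableOn (fun x : ℝ => (1 - x) ^ min q 0) (Ioo 0 1) := by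
    have h1 := (intervalIntegral.intervalIntegrable_rpow' (a := 0) (b := 1) hq').comp_sub_left 1
    simp only [sub_zero, sub_self] at h1
    exact ((intervalIntegrable_iff_integrableOn_Ioo_of_le zero_le_one).1 h1.symm)
  have hfin : ∫⁻ x in Ioo (0 : ℝ) 1, ENNReal.ofReal ((1 - x) ^ min q 0) < ∞ :=
    hint.lintegral_lt_top
  rw [disk, setLIntegral_ball_eq_polar 0 1 hm]
  have hle : ∀ ρ ∈ Ioi (0 : ℝ), ENNReal.ofReal ρ * ∫⁻ θ in Ioo (-Real.pi) Real.pi,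
      (Metric.ball 0 1).indicator (fun u : ℂ => ENNReal.ofReal ((1 - ‖u‖ ^ 2) ^ q))
        (circleMap 0 ρ θ)
      ≤ (Ioo (0 : ℝ) 1).indicator (fun x => ENNReal.ofReal ((1 - x) ^ min q 0)
        * ENNReal.ofReal (2 * Real.pi)) ρ := by
    intro ρ hρ
    have hρ0 : 0 < ρ := hρ
    have hn : ∀ θ, ‖circleMap 0 ρ θ‖ = ρ := fun θ => by simp [abs_of_pos hρ0]
    rcases lt_or_ge ρ 1 with h | h
    · have hi : ∀ θ, (Metric.ball 0 1).indicator
          (fun u : ℂ => ENNReal.ofReal ((1 - ‖u‖ ^ 2) ^ q)) (circleMap 0 ρ θ)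
          = ENNReal.ofReal ((1 - ρ ^ 2) ^ q) := fun θ => by
        rw [indicator_of_mem (by simpa [abs_of_pos hρ0] using h), hn]
      simp only [hi]
      rw [indicator_of_mem (show ρ ∈ Ioo (0 : ℝ) 1 from ⟨hρ0, h⟩), setLIntegral_const,
        Real.volume_Ioo, ← mul_assoc, sub_neg_eq_add, ← two_mul]
      refine mul_le_mul' ?_ le_rfl
      rw [← ENNReal.ofReal_mul hρ0.le]
      refine ENNReal.ofReal_le_ofReal ?_
      have h1 : 0 < 1 - ρ ^ 2 := by nlinarith
      calc ρ * (1 - ρ ^ 2) ^ q ≤ (1 - ρ ^ 2) ^ q :=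
            mul_le_of_le_one_left (by positivity) h.le
        _ ≤ (1 - ρ ^ 2) ^ min q 0 :=
            Real.rpow_le_rpow_of_exponent_ge h1 (by nlinarith) (min_le_left _ _)
        _ ≤ (1 - ρ) ^ min q 0 :=
            Real.rpow_le_rpow_of_nonpos (by linarith) (by nlinarith) (min_le_right _ _)
    · have hi : ∀ θ, (Metric.ball 0 1).indicator
          (fun u : ℂ => ENNReal.ofReal ((1 - ‖u‖ ^ 2) ^ q)) (circleMap 0 ρ θ) = 0 := fun θ =>
        indicator_of_notMem (by simpa [abs_of_pos hρ0] using h) _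
      simp [hi]
  refine (setLIntegral_mono' measurableSet_Ioi hle).trans_lt ?_
  refine (setLIntegral_le_lintegral _ _).trans_lt ?_
  rw [lintegral_indicator measurableSet_Ioo, lintegral_mul_const _ (by fun_prop)]
  exact ENNReal.mul_lt_top hfin ENNReal.ofReal_lt_top

/-- Conformal invariance bounds the Besov seminorms of the automorphisms uniformly. -/
theorem besovIntegral_mobiusFun_le (p : ℝ) {w : ℂ} (hw : w ∈ disk) :
    besovIntegral p (mobiusFun w)
      ≤ (ENNReal.ofReal Real.pi)⁻¹ * ∫⁻ u in disk, ENNReal.ofReal ((1 - ‖u‖ ^ 2) ^ (p - 2)) := by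
  rw [besovIntegral, diskArea, lintegral_smul_measure, smul_eq_mul]
  refine mul_le_mul' le_rfl ?_
  set α' : ℂ → ℂ := fun z => -(1 - ‖w‖ ^ 2 : ℝ) / (1 - (starRingEnd ℂ) w * z) ^ 2 with hα
  have hcv := lintegral_image_eq_lintegral_abs_det_fderiv_mul volume isOpen_disk.measurableSet
    (f := mobius w) (f' := fun z => α' z • (1 : ℂ →L[ℝ] ℂ))
    (fun z hz => (hasDerivAt_mobius hw hz).complexToReal_fderiv.hasFDerivWithinAt)
    (injOn_mobius hw) (fun u => ENNReal.ofReal ((1 - ‖u‖ ^ 2) ^ (p - 2)))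
  have himg : mobius w '' disk ⊆ disk := by
    rintro _ ⟨z, hz, rfl⟩
    exact mobius_mem_disk hw hz
  refine le_trans (le_of_eq ?_) (hcv.symm.le.trans (lintegral_mono_set himg))
  refine setLIntegral_congr_fun isOpen_disk.measurableSet fun z hz => ?_
  have hz1 := one_sub_norm_sq_pos hz
  have hw1 := one_sub_norm_sq_pos hw
  have hD : 0 < ‖1 - (starRingEnd ℂ) w * z‖ := norm_pos_iff.2 (one_sub_conj_mul_ne_zero hw hz)
  have hn : ‖α' z‖ = (1 - ‖w‖ ^ 2) / ‖1 - (starRingEnd ℂ) w * z‖ ^ 2 := by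
    rw [hα]
    simp only [norm_div, norm_neg, norm_pow, Complex.norm_real]
    rw [Real.norm_of_nonneg hw1.le]
  have hpos : 0 < ‖α' z‖ := by
    rw [hn]
    positivity
  -- This identity turns |α'|^p (1 - |z|²)^(p-2) into |α'|² (1 - |α|²)^(p-2), in which |α'|² is the
  -- Jacobian.
  have h1 : 1 - ‖mobius w z‖ ^ 2 = ‖α' z‖ * (1 - ‖z‖ ^ 2) := by
    rw [one_sub_norm_mobius_sq hw hz, hn]
    ring
  rw [(hasDerivAt_mobiusFun hw hz).deriv, det_smul_one, h1, ← ofReal_norm,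
    Real.mul_rpow hpos.le hz1.le, ENNReal.ofReal_rpow_of_pos hpos, Complex.normSq_eq_norm_sq,
    ← ENNReal.ofReal_mul (by positivity), ← ENNReal.ofReal_mul (abs_nonneg _),
    abs_of_nonneg (by positivity), ← mul_assoc]
  congr 2
  rw [← Real.rpow_natCast, ← Real.rpow_add hpos]
  norm_num

theorem mobiusFun_mem (p : ℝ) [hp : Fact (1 ≤ p)] {w : ℂ} (hw : w ∈ disk) :
    mobiusFun w ∈ besovSubmodule p := by
  refine ⟨mobiusFun_mem_holoDisk hw, ?_⟩
  split_ifs with h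
  · exact secondIntegral_mobiusFun_lt_top hw
  · have h1 : 1 < p := lt_of_le_of_ne hp.out (Ne.symm h)
    exact (besovIntegral_mobiusFun_le p hw).trans_lt (ENNReal.mul_lt_top (by simp [Real.pi_pos])
      (lintegral_one_sub_norm_sq_rpow_lt_top (by linarith)))

theorem atomicNorm_smul_mobiusFun_le (c : ℂ) {w : ℂ} (hw : w ∈ disk) :
    atomicNorm (c • mobiusFun w) ≤ ‖c‖ₑ := by
  -- A single atom: its coefficient has index 1, because index 0 holds the constant term, while its
  -- point has index 0.
  refine iInf_le_of_le (Pi.single 1 c) (iInf_le_of_le (fun _ => w) (iInf_le_of_le ⟨?_, ?_, ?_⟩ ?_))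
  · refine summable_of_ne_finset_zero (s := {1}) fun j hj => ?_
    simp [Finset.notMem_singleton.1 hj]
  · exact fun _ => hw
  · intro z hz
    have h : (c • mobiusFun w) z - (Pi.single 1 c : ℕ → ℂ) 0
        = (Pi.single 1 c : ℕ → ℂ) (0 + 1) * mobius w z := by
      simp [mobiusFun_of_mem hz]
    rw [h]
    exact hasSum_single 0 fun j hj => by simp [hj]
  · rw [tsum_eq_single 1 fun j hj => by simp [hj]]
    simp

theorem exists_besovNorm_mobiusFun_le (p : ℝ) (hp : 1 ≤ p) :
    ∃ K < ∞, ∀ w ∈ disk, ∀ c : ℂ, besovNorm p (c • mobiusFun w) ≤ ‖c‖ₑ * K := by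
  by_cases h : p = 1
  · refine ⟨1, ENNReal.one_lt_top, fun w hw c => ?_⟩
    rw [besovNorm, if_pos h, mul_one]
    exact atomicNorm_smul_mobiusFun_le c hw
  · have h1 : 1 < p := lt_of_le_of_ne hp (Ne.symm h)
    have hp0 : 0 < p := by linarith
    refine ⟨1 + ((ENNReal.ofReal Real.pi)⁻¹
      * ∫⁻ u in disk, ENNReal.ofReal ((1 - ‖u‖ ^ 2) ^ (p - 2))) ^ (1 / p), ?_, fun w hw c => ?_⟩
    · refine ENNReal.add_lt_top.2 ⟨ENNReal.one_lt_top,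
        ENNReal.rpow_lt_top_of_nonneg (by positivity) (ENNReal.mul_lt_top (by simp [Real.pi_pos])
          (lintegral_one_sub_norm_sq_rpow_lt_top (by linarith))).ne⟩
    · rw [besovNorm, if_neg h, besovIntegral_smul p hp, mul_add, mul_one,
        ENNReal.mul_rpow_of_nonneg _ _ (by positivity), ← ENNReal.rpow_mul,
        mul_one_div_cancel hp0.ne', ENNReal.rpow_one]
      refine add_le_add ?_ (mul_le_mul' le_rfl
        (ENNReal.rpow_le_rpow (besovIntegral_mobiusFun_le p hw) (by positivity)))
      rw [Pi.smul_apply, smul_eq_mul, enorm_mul, mobiusFun_of_mem zero_mem_disk]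
      refine mul_le_of_le_one_right' ?_
      rw [← ofReal_norm]
      exact ENNReal.ofReal_le_one.2 (norm_mobius_le_one hw zero_mem_disk)

/-! ### Necessity -/

section

variable {ν : ℂ → ℝ} {φ ψ : ℂ → ℂ}

theorem mul_norm_deriv_le_of_blochNorm_lt {f : ℂ → ℂ} {ε : ℝ} {z : ℂ} (hz : z ∈ disk)
    (hν : 0 < ν z) (hε : 0 < ε) (h : blochNorm ν f < ENNReal.ofReal ε) :
    ν z * ‖deriv f z‖ ≤ ε := by
  have h1 : ENNReal.ofReal (ν z) * ‖deriv f z‖ₑ ≤ ENNReal.ofReal ε :=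
    (le_iSup₂ (f := fun z (_ : z ∈ disk) => ENNReal.ofReal (ν z) * ‖deriv f z‖ₑ) z hz).trans
      (le_add_self.trans h.le)
  rwa [← ofReal_norm, ← ENNReal.ofReal_mul hν.le, ENNReal.ofReal_le_ofReal_iff hε.le] at h1

/-- On a compact subset of the little Bloch space, `ν |f'|` vanishes uniformly at the boundary. -/
theorem eventually_forall_mem_compact (hν : ∀ z ∈ disk, 0 < ν z) {K : Set (LittleBloch ν)}
    (hK : IsCompact K) {ε : ℝ} (hε : 0 < ε) :
    ∀ᶠ z in toCircle, ∀ g ∈ K, ν z * ‖deriv g.1 z‖ ≤ ε := by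
  -- Compact induction reduces to neighbourhoods of single elements g: within Bloch distance ε/2 of
  -- g, the decay of ν|g'| carries over up to ε/2.
  refine hK.induction_on (p := fun s => ∀ᶠ z in toCircle, ∀ g ∈ s, ν z * ‖deriv g.1 z‖ ≤ ε)
    (by simp) (fun s t hst ht => ht.mono fun z hz g hg => hz g (hst hg)) (fun s t hs ht => ?_)
    fun g _ => ?_
  · filter_upwards [hs, ht] with z h1 h2 g hg
    exact hg.elim (h1 g) (h2 g)
  · refine ⟨{u | edist u g < ENNReal.ofReal (ε / 2)}, mem_nhdsWithin_of_mem_nhds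
      (Metric.eball_mem_nhds g (by simpa using hε)), ?_⟩
    have h1 := g.2.2.2.eventually (gt_mem_nhds (half_pos hε))
    filter_upwards [h1, eventually_disk] with z hz hzd u hu
    have h2 : blochNorm ν (u.1 - g.1) < ENNReal.ofReal (ε / 2) := hu
    have h3 := mul_norm_deriv_le_of_blochNorm_lt hzd (hν z hzd) (half_pos hε) h2
    have h4 : deriv u.1 z = deriv (u.1 - g.1) z + deriv g.1 z := by
      rw [← deriv_add_disk (u.2.1.1.sub g.2.1.1) g.2.1.1 hzd, sub_add_cancel]
    rw [h4]
    have h5 := mul_le_mul_of_nonneg_left (norm_add_le (deriv (u.1 - g.1) z) (deriv g.1 z))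
      (hν z hzd).le
    linarith

/-- For one fixed c > 0 all the functions c α_w lie in the neighbourhood of 0 that the operator
sends into a compact set. The boundary decay is therefore uniform in w, which is essential because
the test points w are later chosen depending on z. -/
theorem eventually_mobiusKernel_le (p : ℝ) [hp : Fact (1 ≤ p)] (hν : ∀ z ∈ disk, 0 < ν z)
    (hφ : DifferentiableOn ℂ φ disk) (hφm : MapsTo φ disk disk)
    (hψ : DifferentiableOn ℂ ψ disk) (hψm : MapsTo ψ disk disk)
    (T : Besov p →L[ℂ] LittleBloch ν)
    (hT : ∀ f : Besov p, ∀ z ∈ disk, (T f) z = f (φ z) - f (ψ z)) (hc : IsCompactOperator T)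
    {ε : ℝ} (hε : 0 < ε) :
    ∀ᶠ z in toCircle, ∀ w ∈ disk,
      ‖(ν z : ℂ) * deriv φ z / (1 - ‖φ z‖ ^ 2) * mobiusKernel w (φ z)
        - (ν z : ℂ) * deriv ψ z / (1 - ‖ψ z‖ ^ 2) * mobiusKernel w (ψ z)‖ ≤ ε := by
  obtain ⟨K, hK, hKT⟩ := hc
  obtain ⟨e, he, hball⟩ := EMetric.mem_nhds_iff.1 hKT
  obtain ⟨B, hB, hBw⟩ := exists_besovNorm_mobiusFun_le p hp.out
  -- The radius e may be infinite, so c comes from a limit at 0⁺ rather than from a quotient.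
  obtain ⟨c, hc0, hce⟩ : ∃ c : ℝ, 0 < c ∧ ENNReal.ofReal c * B < e := by
    have h1 : Tendsto (fun c : ℝ => ENNReal.ofReal c * B) (𝓝[>] 0) (𝓝 0) := by
      have := ENNReal.Tendsto.mul_const (ENNReal.tendsto_ofReal (tendsto_id (x := 𝓝 (0 : ℝ))))
        (Or.inr hB.ne)
      simp only [ENNReal.ofReal_zero, zero_mul] at this
      exact this.mono_left nhdsWithin_le_nhds
    obtain ⟨c, h2, h3⟩ := ((h1.eventually (gt_mem_nhds he)).and self_mem_nhdsWithin).exists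
    exact ⟨c, h3, h2⟩
  have hev := eventually_forall_mem_compact hν hK (mul_pos hε hc0)
  filter_upwards [hev, eventually_disk] with z hz hzd w hw
  let f : Besov p := ⟨(c : ℂ) • mobiusFun w, (besovSubmodule p).smul_mem _ (mobiusFun_mem p hw)⟩
  have hfK : T f ∈ K := by
    refine hball ?_
    have h1 : edist f 0 = besovNorm p ((c : ℂ) • mobiusFun w - 0) := rfl
    change edist f 0 < e
    rw [h1, sub_zero]
    refine (hBw w hw c).trans_lt ?_
    rwa [← ofReal_norm, Complex.norm_real, Real.norm_of_nonneg hc0.le]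
  have h1 := hz _ hfK
  have h2 : (T f).1 =ᶠ[𝓝 z] diffComp φ ψ f.1 := by
    filter_upwards [isOpen_disk.mem_nhds hzd] with u hu
    rw [diffComp_of_mem hu]
    exact hT f u hu
  have hd : ∀ u ∈ disk, deriv f.1 u = c * (-(1 - ‖w‖ ^ 2 : ℝ) / (1 - (starRingEnd ℂ) w * u) ^ 2) :=
    fun u hu => by
      rw [← (hasDerivAt_mobiusFun hw hu).deriv]
      exact deriv_smul_disk _ _ _
  rw [h2.deriv_eq, (hasDerivAt_diffComp hφ hφm hψ hψm f.2.1.1 hzd).deriv, hd _ (hφm hzd),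
    hd _ (hψm hzd)] at h1
  have hk : ∀ u ∈ disk, ∀ d : ℂ, (ν z : ℂ) * d / (1 - ‖u‖ ^ 2) * mobiusKernel w u
      = (ν z : ℂ) * ((1 - ‖w‖ ^ 2 : ℝ) / (1 - (starRingEnd ℂ) w * u) ^ 2 * d) := fun u hu d => by
    have h3 : (1 - (‖u‖ : ℂ) ^ 2) ≠ 0 := by exact_mod_cast (one_sub_norm_sq_pos hu).ne'
    have h4 := one_sub_conj_mul_ne_zero hw hu
    rw [mobiusKernel]
    push_cast
    field_simp
  have e1 : (ν z : ℂ) * deriv φ z / (1 - ‖φ z‖ ^ 2) * mobiusKernel w (φ z)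
        - (ν z : ℂ) * deriv ψ z / (1 - ‖ψ z‖ ^ 2) * mobiusKernel w (ψ z)
      = -((ν z : ℂ) * (c : ℂ)⁻¹ * (c * (-(1 - ‖w‖ ^ 2 : ℝ) / (1 - (starRingEnd ℂ) w * φ z) ^ 2)
          * deriv φ z - c * (-(1 - ‖w‖ ^ 2 : ℝ) / (1 - (starRingEnd ℂ) w * ψ z) ^ 2)
          * deriv ψ z)) := by
    have hc' : (c : ℂ) ≠ 0 := by exact_mod_cast hc0.ne'
    rw [hk _ (hφm hzd), hk _ (hψm hzd), neg_div, neg_div]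
    generalize ((1 - ‖w‖ ^ 2 : ℝ) : ℂ) / (1 - (starRingEnd ℂ) w * φ z) ^ 2 = x
    generalize ((1 - ‖w‖ ^ 2 : ℝ) : ℂ) / (1 - (starRingEnd ℂ) w * ψ z) ^ 2 = y
    field_simp
    ring
  rw [e1, norm_neg, norm_mul, norm_mul, norm_inv, Complex.norm_real, Complex.norm_real,
    Real.norm_of_nonneg (hν z hzd).le, Real.norm_of_nonneg hc0.le, mul_right_comm,
    ← div_eq_mul_inv, div_le_iff₀ hc0]
  exact h1

theorem tendsto_of_compact_operator (p : ℝ) [hp : Fact (1 ≤ p)] (hν : ∀ z ∈ disk, 0 < ν z)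
    (hφ : DifferentiableOn ℂ φ disk) (hφm : MapsTo φ disk disk)
    (hψ : DifferentiableOn ℂ ψ disk) (hψm : MapsTo ψ disk disk)
    (T : Besov p →L[ℂ] LittleBloch ν)
    (hT : ∀ f : Besov p, ∀ z ∈ disk, (T f) z = f (φ z) - f (ψ z)) (hc : IsCompactOperator T) :
    Tendsto (distortion ν φ ψ) toCircle (𝓝 0) ∧
      Tendsto (hypDerivDiff ν φ ψ) toCircle (𝓝 0) := by
  have key : ∀ ε > 0, ∀ᶠ z in toCircle,
      |distortion ν φ ψ z| < ε ∧ |hypDerivDiff ν φ ψ z| < ε := fun ε hε => by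
    filter_upwards [eventually_mobiusKernel_le p hν hφ hφm hψ hψm T hT hc
      -- The largest constant produced by the test is 16, so 17 leaves strict inequalities.
      (show 0 < ε / 17 by positivity), eventually_disk] with z hz hzd
    obtain ⟨h1, h2, h3⟩ := mobiusKernel_test (hφm hzd) (hψm hzd) hz
    have hn : ∀ u ∈ disk, ∀ d : ℂ,
        ‖(ν z : ℂ) * d / (1 - ‖u‖ ^ 2)‖ = ‖d‖ / (1 - ‖u‖ ^ 2) * ν z := fun u hu d => by
      have : (1 - (‖u‖ : ℂ) ^ 2) = ((1 - ‖u‖ ^ 2 : ℝ) : ℂ) := by push_cast; rfl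
      rw [this, norm_div, norm_mul, Complex.norm_real, Complex.norm_real,
        Real.norm_of_nonneg (hν z hzd).le, Real.norm_of_nonneg (one_sub_norm_sq_pos hu).le]
      ring
    rw [hn _ (hφm hzd)] at h1
    rw [hn _ (hψm hzd)] at h2
    have hνz := (hν z hzd).le
    have hρ : 0 ≤ pseudoHyp (φ z) (ψ z) := norm_nonneg _
    have hφ1 := one_sub_norm_sq_pos (hφm hzd)
    constructor
    · rw [distortion, abs_of_nonneg (mul_nonneg (mul_nonneg
        (le_max_of_le_left (by positivity)) hνz) hρ), max_mul_of_nonneg _ _ hνz,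
        max_mul_of_nonneg _ _ hρ]
      exact max_lt (by linarith) (by linarith)
    · rw [hypDerivDiff, abs_of_nonneg (norm_nonneg _)]
      linarith
  constructor
  · refine Metric.tendsto_nhds.2 fun ε hε => (key ε hε).mono fun z hz => ?_
    rw [Real.dist_0_eq_abs]
    exact hz.1
  · refine Metric.tendsto_nhds.2 fun ε hε => (key ε hε).mono fun z hz => ?_
    rw [Real.dist_0_eq_abs]
    exact hz.2

end

end DiffComp

/-! ### The characterization of compactness -/

theorem theorem4p1 (p : ℝ) [Fact (1 ≤ p)] (ν : ℂ → ℝ)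
    (hν_cont : ContinuousOn ν DiffComp.disk)
    (hν_pos : ∀ z ∈ DiffComp.disk, 0 < ν z)
    (hν_radial : ∀ z ∈ DiffComp.disk, ν z = ν ((‖z‖ : ℝ) : ℂ))
    (φ ψ : ℂ → ℂ)
    (hφ : DifferentiableOn ℂ φ DiffComp.disk) (hφ_maps : MapsTo φ DiffComp.disk DiffComp.disk)
    (hψ : DifferentiableOn ℂ ψ DiffComp.disk) (hψ_maps : MapsTo ψ DiffComp.disk DiffComp.disk) :
    (∃ T : DiffComp.Besov p →L[ℂ] DiffComp.LittleBloch ν,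
      (∀ f : DiffComp.Besov p, ∀ z ∈ DiffComp.disk, (T f) z = f (φ z) - f (ψ z)) ∧
      IsCompactOperator T) ↔
    (Tendsto (fun z : ℂ =>
        max (‖deriv φ z‖ / (1 - ‖φ z‖ ^ 2)) (‖deriv ψ z‖ / (1 - ‖ψ z‖ ^ 2))
          * ν z * DiffComp.pseudoHyp (φ z) (ψ z))
        DiffComp.toCircle (𝓝 0) ∧
      Tendsto (fun z : ℂ =>
        ‖(ν z : ℂ) * deriv φ z / (1 - ‖φ z‖ ^ 2) - (ν z : ℂ) * deriv ψ z / (1 - ‖ψ z‖ ^ 2)‖)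
        DiffComp.toCircle (𝓝 0)) := by
  constructor
  · rintro ⟨T, hT, hc⟩
    exact DiffComp.tendsto_of_compact_operator p hν_pos hφ hφ_maps hψ hψ_maps T hT hc
  · rintro ⟨hd, hh⟩
    exact DiffComp.exists_compact_operator p hν_cont hν_pos hφ hφ_maps hψ hψ_maps hd hh
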